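/- Let $\varphi(x)=\sqrt{1-x^2}$ and let $\|\cdot\|_p$ be the norm of $L_p[-1,1]$, $1\le p\le\infty$. For $f\in L_p[-1,1]$ let $E_n(f)_p=\inf\|f-P\|_p$, the infimum over all real polynomials $P$ of degree $<n$. Put $\mathbb B_p^0=L_p[-1,1]$ and, for $r\ge 1$, let $\mathbb B_p^r$ be the set of $f$ whose derivative $f^{(r-1)}$ exists and is locally absolutely continuous in $(-1,1)$ and for which $\|f^{(r)}\varphi^r\|_p<\infty$; a function $f\in L_p[-1,1]$ is said to be in $\mathbb B_p^r$ if it coincides almost everywhere with such a function, and $f^{(r)}$ is then the derivative of that representative. For $k\ge1$ and $h\ge0$ let $\Delta_h^k(F,x)=\sum_{i=0}^k\binom ki(-1)^{k-i}F\bigl(x+(i-k/2)h\bigr)$ if $x\pm kh/2\in[-1,1]$, and $\Delta_h^k(F,x)=0$ otherwise. For $f\in\mathbb B_p^r$ and $t>0$ let $$\omega_{k,r}^\varphi(f^{(r)},t)_p=\sup_{0\le h\le t}\bigl\|\mathcal W_{kh}^r(\cdot)\,\Delta_{h\varphi(\cdot)}^k(f^{(r)},\cdot)\bigr\|_p,\qquad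 \mathcal W_\delta(x)=\bigl((1-x-\delta\varphi(x)/2)(1+x-\delta\varphi(x)/2)\bigr)^{1/2}.$$ Let $r\ge 0$ and $k\ge 1$ be integers. There are constants $c(\alpha,k,r)$, depending only on $\alpha,k,r$, and $c(N,k,r)$, depending only on $N,k,r$, such that the following holds for all real $\alpha$ with $r<\alpha<r+k$, all $1\le p\le\infty$, all $f\in L_p[-1,1]$ and all integers $N\ge k+r$. If $$E_n(f)_p\le n^{-\alpha}\quad\text{for all } n\ge N,$$ then $f\in\mathbb B_p^r$ and $$\omega_{k,r}^\varphi(f^{(r)},t)_p\le c(\alpha,k,r)\,t^{\alpha-r}+c(N,k,r)\,t^k E_{k+r}(f)_p,\qquad t>0.$$ In particular, if $N=k+r$, then $f\in\mathbb B_p^r$ and $$\omega_{k,r}^\varphi(f^{(r)},t)_p\le c(\alpha,k,r)\,t^{\alpha-r},\qquad t>0.$$ -/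

import Mathlib

open MeasureTheory Set
open scoped ENNReal NNReal ContDiff

noncomputable section

namespace AlgApprox

/-- Lebesgue measure on `[-1, 1]`. -/
def μI : Measure ℝ := volume.restrict (Icc (-1 : ℝ) 1)

/-- The weight `φ(x) = √(1 - x²)`. -/
def phi (x : ℝ) : ℝ := Real.sqrt (1 - x ^ 2)

/-- The weight `w_δ(x) = ((1 - x - δφ(x)/2)(1 + x - δφ(x)/2))^{1/2}`. -/
def wt (δ x : ℝ) : ℝ :=
  Real.sqrt ((1 - x - δ * phi x / 2) * (1 + x - δ * phi x / 2))

open Classical in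
/-- The `k`th symmetric difference `Δ_h^k(f, x)` relative to `[-1, 1]`: it is `0` unless both
endpoints `x ± kh/2` lie in `[-1, 1]`. -/
def symmDiffK (k : ℕ) (h : ℝ) (f : ℝ → ℝ) (x : ℝ) : ℝ :=
  if x - k * h / 2 ∈ Icc (-1 : ℝ) 1 ∧ x + k * h / 2 ∈ Icc (-1 : ℝ) 1 then
    ∑ i ∈ Finset.range (k + 1),
      (k.choose i : ℝ) * (-1) ^ (k - i) * f (x + ((i : ℝ) - (k : ℝ) / 2) * h)
  else 0

/-- `f` (restricted to `(-1, 1)`) is a function of the class `𝔹_p^r`. For `r = 0` this is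
`L_p[-1, 1]`; for `r ≥ 1` the derivative `f^{(r-1)}` exists and is locally absolutely continuous
in `(-1, 1)`, and the norm of `f^{(r)} φ^r` in `L_p[-1, 1]` is finite (`f^{(r)}` exists almost
everywhere). -/
def MemB (p : ℝ≥0∞) : ℕ → (ℝ → ℝ) → Prop
  | 0, f => MemLp f p μI
  | s + 1, f =>
      ContDiffOn ℝ (s : ℕ∞ω) f (Ioo (-1) 1) ∧
      (∀ a b : ℝ, -1 < a → a ≤ b → b < 1 →
        AbsolutelyContinuousOnInterval (iteratedDeriv s f) a b) ∧
      eLpNorm (fun x => iteratedDeriv (s + 1) f x * phi x ^ (s + 1)) p μI < ⊤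

/-- The modulus `ω_{k,r}^φ(F, t)_p = sup_{0 ≤ h ≤ t} ‖w_{kh}^r Δ_{hφ}^k(F, ·)‖_p`, which is to be
applied to `F = f^{(r)}`. -/
def modulus (k r : ℕ) (p : ℝ≥0∞) (F : ℝ → ℝ) (t : ℝ) : ℝ≥0∞ :=
  ⨆ h ∈ Icc (0 : ℝ) t,
    eLpNorm (fun x => wt (k * h) x ^ r * symmDiffK k (h * phi x) F x) p μI

/-- `E_n(f)_p`: the degree of approximation of `f` in `L_p[-1, 1]` by real polynomials of
degree `< n`. -/
def bestApprox (n : ℕ) (p : ℝ≥0∞) (f : ℝ → ℝ) : ℝ≥0∞ :=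
  ⨅ (P : Polynomial ℝ) (_ : P.degree < (n : WithBot ℕ)), eLpNorm (fun x => f x - P.eval x) p μI

end AlgApprox

end

/-! The argument is the classical inverse theorem: dyadic approximation plus Bernstein. Take
polynomials `P j` of degree below `2 ^ (N + j)` whose error is at most twice the assumed rate. The
difference `Q = P (j + 1) - P j` has degree below n = 2^(N+j+1) and norm O(n^(-α)). Two facts turn
this into the claim.

(a) Bernstein: ‖φ^s Q^(s)‖_p ≤ (4n)^s ‖Q‖_p (`bernstein`). For s ≤ r < α the weighted derivatives
are therefore summable over j. Hence the sequence converges almost everywhere, its limit represents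
f, and this representative lies in 𝔹_p^r (`memB_limFun`, `ae_eq_limFun`).

(b) Weighted differences of a smooth F satisfy two bounds, one by ‖φ^r F‖_p and one by h^k ‖φ^(k+r)
F^(k)‖_p (`eLpNorm_symmDiffK_le`, `eLpNorm_symmDiffK_le_derivative`). With F = Q^(r) and Bernstein
they give C n^r min(1, (nh)^k) ‖Q‖_p. Summed over dyadic n this is O(t^(α-r)), because 0 < α - r < k
(`exists_dyadic_sum_le`).

There remains the first polynomial `P 0`. If R has degree below k + r and is nearly best for f, then
`P 0` and `P 0 - R` have the same derivatives of order k + r, so (b) bounds this term by C(N) h^k ‖P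
0 - R‖_p, and R and `P 0` may be taken so that this norm is arbitrarily close to at most 2
E_{k+r}(f)_p.

Bernstein's inequality is proved on the sphere. The function S(z)(x + iy)^m has modulus φ(z)^m
|S(z)| there, and along each rotation about a horizontal axis it is a trigonometric polynomial of
degree at most deg S + m. Its derivative along a rotation is a fixed combination of rotated copies
with coefficients of total mass at most 2n (`exists_trig_interpolation`), so rotation invariance
bounds the L_p norm of that derivative. Two such derivatives combine to -S'(z)(x + iy)^(m+1). By
Archimedes' theorem the height z is uniformly distributed, so norms on the sphere are unweighted
norms on [-1, 1]. Lebesgue measure on the punctured ball, with functions homogeneous of degree 0,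
replaces surface measure. -/

namespace AlgApprox

/-! ### Trigonometric polynomials and discrete Bernstein interpolation -/

open Complex in
/-- `T` is a trigonometric polynomial of degree at most `n`. -/
def IsTrig (n : ℕ) (T : ℝ → ℂ) : Prop :=
  ∃ p : Polynomial ℂ, p.natDegree ≤ 2 * n ∧
    ∀ t : ℝ, T t = exp (-(n * t * I)) * p.eval (exp (t * I))

open Complex in
lemma IsTrig.mul {m n : ℕ} {S T : ℝ → ℂ} (hS : IsTrig m S) (hT : IsTrig n T) :
    IsTrig (m + n) (fun t => S t * T t) := by
  obtain ⟨p, hp, hpS⟩ := hS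
  obtain ⟨q, hq, hqT⟩ := hT
  refine ⟨p * q, Polynomial.natDegree_mul_le.trans (by omega), fun t => ?_⟩
  have : exp (-((m + n : ℕ) * t * I)) = exp (-(m * t * I)) * exp (-(n * t * I)) := by
    rw [← exp_add]; push_cast; ring_nf
  simp only [hpS, hqT, this, Polynomial.eval_mul]
  ring

open Complex in
lemma IsTrig.mono {m n : ℕ} {S : ℝ → ℂ} (hS : IsTrig m S) (h : m ≤ n) : IsTrig n S := by
  obtain ⟨p, hp, hpS⟩ := hS
  obtain ⟨d, rfl⟩ := Nat.exists_eq_add_of_le h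
  refine ⟨p * Polynomial.X ^ d, Polynomial.natDegree_mul_le.trans ?_, fun t => ?_⟩
  · rw [Polynomial.natDegree_X_pow]; omega
  have : exp (-((m + d : ℕ) * t * I)) * exp (t * I) ^ d = exp (-(m * t * I)) := by
    rw [← exp_nat_mul, ← exp_add]; push_cast; ring_nf
  rw [hpS, ← this, Polynomial.eval_mul, Polynomial.eval_pow, Polynomial.eval_X]
  ring

lemma IsTrig.add {n : ℕ} {S T : ℝ → ℂ} (hS : IsTrig n S) (hT : IsTrig n T) :
    IsTrig n (fun t => S t + T t) := by
  obtain ⟨p, hp, hpS⟩ := hS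
  obtain ⟨q, hq, hqT⟩ := hT
  refine ⟨p + q, (Polynomial.natDegree_add_le _ _).trans (max_le hp hq), fun t => ?_⟩
  simp only [hpS, hqT, Polynomial.eval_add]
  ring

lemma isTrig_const (c : ℂ) : IsTrig 0 (fun _ => c) :=
  ⟨Polynomial.C c, by simp, fun t => by simp⟩

lemma IsTrig.pow {n : ℕ} {S : ℝ → ℂ} (hS : IsTrig n S) (m : ℕ) :
    IsTrig (m * n) (fun t => S t ^ m) := by
  induction m with
  | zero => simpa using isTrig_const 1
  | succ m ih =>
    simp only [pow_succ, Nat.succ_mul]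
    exact ih.mul hS

open Complex in
lemma isTrig_cos_sin (a b c : ℂ) :
    IsTrig 1 (fun t => a * Real.cos t + b * Real.sin t + c) := by
  refine ⟨Polynomial.C ((a - b * I) / 2) * Polynomial.X ^ 2 + Polynomial.C c * Polynomial.X +
    Polynomial.C ((a + b * I) / 2), ?_, fun t => ?_⟩
  · exact Polynomial.natDegree_quadratic_le
  · have h1 : exp (-((1 : ℕ) * t * I)) * exp (t * I) = 1 := by
      rw [← exp_add]; simp
    have h2 : exp (-((1 : ℕ) * t * I)) = cos t - sin t * I := by
      have := exp_mul_I (-(t : ℂ))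
      rw [cos_neg, sin_neg] at this
      rw [show -((1 : ℕ) * (t : ℂ) * I) = -(t : ℂ) * I by push_cast; ring, this]; ring
    have h3 := exp_mul_I (t : ℂ)
    simp only [Polynomial.eval_add, Polynomial.eval_mul, Polynomial.eval_C, Polynomial.eval_pow,
      Polynomial.eval_X, ofReal_cos, ofReal_sin]
    have e : ∀ u v A B : ℂ, v * u = 1 → v * (A * u ^ 2 + c * u + B) = A * u + c + B * v := by
      intro u v A B h
      linear_combination (A * u + c) * h
    rw [e _ _ _ _ h1, h2, h3]
    linear_combination (b * sin t) * I_sq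

lemma IsTrig.eval {S : ℝ → ℂ} (hS : IsTrig 1 S) (Q : Polynomial ℂ) :
    IsTrig Q.natDegree (fun t => Q.eval (S t)) := by
  have : ∀ s : Finset ℕ, (∀ i ∈ s, i ≤ Q.natDegree) →
      IsTrig Q.natDegree (fun t => ∑ i ∈ s, Q.coeff i * S t ^ i) := by
    intro s
    induction s using Finset.induction_on with
    | empty =>
      intro _
      simpa using (isTrig_const 0).mono (Nat.zero_le _)
    | insert a s ha ih =>
      intro h
      simp only [Finset.sum_insert ha]
      refine IsTrig.add ?_ (ih fun i hi => h i (Finset.mem_insert_of_mem hi))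
      refine (((isTrig_const (Q.coeff a)).mul (hS.pow a))).mono ?_
      have := h a (Finset.mem_insert_self _ _)
      omega
  simp only [Polynomial.eval_eq_sum_range]
  exact this _ fun i hi => by simpa [Nat.lt_succ_iff] using hi

lemma sum_zpow_primitiveRoot {M : ℕ} {ζ : ℂ} (hζ : IsPrimitiveRoot ζ M)
    {z : ℤ} (hz : |z| < M) :
    ∑ l ∈ Finset.range M, (ζ ^ l) ^ z = if z = 0 then (M : ℂ) else 0 := by
  split_ifs with h
  · simp [h]
  · have h1 : ζ ^ z ≠ 1 := by
      intro h1
      rw [hζ.zpow_eq_one_iff_dvd] at h1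
      exact h (Int.eq_zero_of_abs_lt_dvd h1 hz)
    have h2 : (ζ ^ z) ^ M = 1 := by
      rw [← zpow_natCast, ← zpow_mul, mul_comm, zpow_mul, zpow_natCast, hζ.pow_eq_one, one_zpow]
    have h3 := mul_neg_geom_sum (ζ ^ z) M
    rw [h2, sub_self, mul_eq_zero] at h3
    have h4 := h3.resolve_left (sub_ne_zero.2 (Ne.symm h1))
    rw [← h4]
    refine Finset.sum_congr rfl fun l _ => ?_
    rw [← zpow_natCast, ← zpow_mul, mul_comm, zpow_mul, zpow_natCast]

/-- These are the coefficients of the Fejér kernel. Truncated subtraction makes the coefficient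
vanish for d ≥ n. -/
lemma card_filter_add (n d : ℕ) :
    ∑ a ∈ Finset.range n, ∑ b ∈ Finset.range n, (if b = a + d then (1 : ℂ) else 0)
      = ((n - d : ℕ) : ℂ) := by
  have : ∀ a ∈ Finset.range n, ∑ b ∈ Finset.range n, (if b = a + d then (1 : ℂ) else 0)
      = if a < n - d then 1 else 0 := by
    intro a _
    rw [Finset.sum_ite_eq']
    simp only [Finset.mem_range]
    congr 1
    exact propext (by omega)
  rw [Finset.sum_congr rfl this, Finset.sum_ite, Finset.sum_const_zero, add_zero,
    Finset.sum_const, nsmul_eq_mul, mul_one]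
  congr 1
  have : (Finset.range n).filter (fun a => a < n - d) = Finset.range (n - d) := by
    ext a; simp only [Finset.mem_filter, Finset.mem_range]; omega
  rw [this, Finset.card_range]

/-- Fejér-type sum. -/
noncomputable def fejerSum (n : ℕ) (w : ℂ) : ℂ :=
  ∑ a ∈ Finset.range n, ∑ b ∈ Finset.range n, w ^ ((a : ℤ) - b)

lemma fejerSum_eq_normSq (n : ℕ) {w : ℂ} (hw : ‖w‖ = 1) :
    fejerSum n w = ((‖∑ a ∈ Finset.range n, w ^ a‖ ^ 2 : ℝ) : ℂ) := by
  have hw0 : w ≠ 0 := by rintro rfl; simp at hw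
  have hc : (starRingEnd ℂ) w = w⁻¹ := (Complex.inv_eq_conj hw).symm
  rw [fejerSum, Complex.ofReal_pow, ← Complex.mul_conj', map_sum, Finset.sum_mul_sum]
  refine Finset.sum_congr rfl fun a _ => Finset.sum_congr rfl fun b _ => ?_
  rw [map_pow, hc, zpow_sub₀ hw0, zpow_natCast, zpow_natCast, inv_pow, div_eq_mul_inv]

/-- The bound on the exponents excludes aliasing, so by orthogonality of the roots of unity the
discrete sum is an exact Fourier coefficient of the Fejér kernel. -/
lemma sum_fejer_zpow {n : ℕ} {ζ : ℂ} (hζ : IsPrimitiveRoot ζ (3 * n)) (z : ℤ)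
    (h1 : ∀ a < n, ∀ b < n, |z + (a - b : ℤ)| < (3 * n : ℕ)) :
    ∑ l ∈ Finset.range (3 * n), (ζ ^ l) ^ z * fejerSum n (ζ ^ l) =
      (3 * n : ℕ) * ∑ a ∈ Finset.range n, ∑ b ∈ Finset.range n,
        (if z + (a - b : ℤ) = 0 then (1 : ℂ) else 0) := by
  rcases Nat.eq_zero_or_pos n with rfl | hn
  · simp
  have hζ0 : ζ ≠ 0 := hζ.ne_zero (by omega)
  simp only [fejerSum, Finset.mul_sum]
  rw [Finset.sum_comm]
  refine Finset.sum_congr rfl fun a ha => ?_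
  rw [Finset.sum_comm]
  refine Finset.sum_congr rfl fun b hb => ?_
  simp only [← zpow_add₀ (pow_ne_zero _ hζ0)]
  rw [sum_zpow_primitiveRoot hζ (h1 a (Finset.mem_range.1 ha) b (Finset.mem_range.1 hb))]
  simp

open Complex in
/-- The derivative at `0` of a trigonometric polynomial of degree `n` is a combination of its
values at `3n` equally spaced points, with coefficients of total mass at most `2n`. -/
theorem exists_trig_interpolation (n : ℕ) (hn : 1 ≤ n) :
    ∃ c : ℕ → ℂ, ∑ l ∈ Finset.range (3 * n), ‖c l‖ ≤ 2 * n ∧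
      ∀ T : ℝ → ℂ, IsTrig n T → ∀ d : ℂ, HasDerivAt T d 0 →
        d = ∑ l ∈ Finset.range (3 * n), c l * T (2 * Real.pi * l / (3 * n : ℕ)) := by
  have hM : (3 * n : ℕ) ≠ 0 := by omega
  have hMC : ((3 * n : ℕ) : ℂ) ≠ 0 := by exact_mod_cast hM
  set ζ : ℂ := exp (2 * Real.pi * I / (3 * n : ℕ)) with hζdef
  have hζ : IsPrimitiveRoot ζ (3 * n) := isPrimitiveRoot_exp _ hM
  have hζ0 : ζ ≠ 0 := exp_ne_zero _
  have hζn : ‖ζ‖ = 1 := hζ.norm'_eq_one hM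
  have hln : ∀ l : ℕ, ‖ζ ^ l‖ = 1 := fun l => by rw [norm_pow, hζn, one_pow]
  have hl0 : ∀ l : ℕ, ζ ^ l ≠ 0 := fun l => pow_ne_zero _ hζ0
  -- The multiplier q - n of differentiation is a difference of two Fejér triangles, centred at
  -- frequencies n and -n. Shifting the kernel by ±n gives these coefficients. Positivity of the
  -- kernel gives the mass 2n, and 3n nodes suffice because the exponents that occur are below 2n +
  -- n in modulus.
  refine ⟨fun l => ((3 * n : ℕ) : ℂ)⁻¹ * (I * ((ζ ^ l) ^ (-(n : ℤ)) - (ζ ^ l) ^ (n : ℤ)) *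
    fejerSum n (ζ ^ l)), ?_, ?_⟩
  · have hsum : ∑ l ∈ Finset.range (3 * n), ‖∑ a ∈ Finset.range n, (ζ ^ l) ^ a‖ ^ 2
        = (3 * n : ℕ) * n := by
      have := sum_fejer_zpow hζ 0 (fun a ha b hb => by rw [zero_add, abs_lt]; constructor <;> omega)
      have h2 := card_filter_add n 0
      have h3 : ∀ a b : ℕ, (0 + (a - b : ℤ) = 0) ↔ b = a + 0 := fun a b => by omega
      simp only [h3, h2, zpow_zero, one_mul, fejerSum_eq_normSq n (hln _)] at this
      exact_mod_cast this
    refine le_trans (b := ∑ l ∈ Finset.range (3 * n), ((3 * n : ℕ) : ℝ)⁻¹ *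
          (2 * ‖∑ a ∈ Finset.range n, (ζ ^ l) ^ a‖ ^ 2)) ?_ (le_of_eq ?_)
    · refine Finset.sum_le_sum fun l _ => ?_
      rw [norm_mul, norm_mul, norm_mul, norm_I, one_mul, fejerSum_eq_normSq n (hln _),
        norm_inv, norm_natCast, norm_real, Real.norm_of_nonneg (sq_nonneg _)]
      gcongr
      refine (norm_sub_le _ _).trans ?_
      rw [norm_zpow, norm_zpow, hln, one_zpow, one_zpow]; norm_num
    · rw [← Finset.mul_sum, ← Finset.mul_sum, hsum]
      have : ((3 * n : ℕ) : ℝ) ≠ 0 := by exact_mod_cast hM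
      field_simp
  · rintro T ⟨p, hp, hT⟩ d hd
    have hd' : d = I * ∑ q ∈ Finset.range (2 * n + 1), p.coeff q * ((q : ℂ) - n) := by
      have hT' : T = fun t : ℝ => ∑ q ∈ Finset.range (2 * n + 1),
          p.coeff q * exp (((q : ℂ) - n) * I * (t : ℂ)) := by
        funext t
        rw [hT, Polynomial.eval_eq_sum_range' (Nat.lt_succ_of_le hp), Finset.mul_sum]
        refine Finset.sum_congr rfl fun q _ => ?_
        rw [mul_left_comm, ← exp_nat_mul, ← exp_add]
        congr 2; ring
      have hder : HasDerivAt T (∑ q ∈ Finset.range (2 * n + 1),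
          p.coeff q * (((q : ℂ) - n) * I)) 0 := by
        rw [hT']
        refine HasDerivAt.fun_sum fun q _ => ?_
        have h1 : HasDerivAt (fun t : ℝ => ((q : ℂ) - n) * I * (t : ℂ)) (((q : ℂ) - n) * I) 0 := by
          simpa using (ofRealCLM.hasDerivAt (x := (0 : ℝ))).const_mul (((q : ℂ) - n) * I)
        simpa using (h1.cexp).const_mul (p.coeff q)
      rw [hd.unique hder, Finset.mul_sum]
      exact Finset.sum_congr rfl fun q _ => by ring
    have hTl : ∀ l : ℕ, T (2 * Real.pi * l / (3 * n : ℕ)) =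
        ∑ q ∈ Finset.range (2 * n + 1), p.coeff q * (ζ ^ l) ^ ((q : ℤ) - n) := by
      intro l
      have he : exp (((2 * Real.pi * l / (3 * n : ℕ) : ℝ) : ℂ) * I) = ζ ^ l := by
        rw [hζdef, ← exp_nat_mul]; congr 1; push_cast; ring
      have he2 : exp (-(n * ((2 * Real.pi * l / (3 * n : ℕ) : ℝ) : ℂ) * I)) =
          (ζ ^ l) ^ (-(n : ℤ)) := by
        rw [← he, ← exp_int_mul]; congr 1; push_cast; ring
      rw [hT, he, he2, Polynomial.eval_eq_sum_range' (Nat.lt_succ_of_le hp), Finset.mul_sum]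
      refine Finset.sum_congr rfl fun q _ => ?_
      rw [mul_left_comm, ← zpow_natCast (ζ ^ l) q, ← zpow_add₀ (hl0 l)]
      congr 2; ring
    rw [hd', Finset.mul_sum]
    simp only [hTl, Finset.mul_sum]
    rw [Finset.sum_comm]
    refine Finset.sum_congr rfl fun q hq => ?_
    have hq' : q ≤ 2 * n := by simpa [Nat.lt_succ_iff] using hq
    have s1 := sum_fejer_zpow hζ ((q : ℤ) - 2 * n)
      (fun a ha b hb => by rw [abs_lt]; constructor <;> push_cast <;> omega)
    have s2 := sum_fejer_zpow hζ (q : ℤ)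
      (fun a ha b hb => by rw [abs_lt]; constructor <;> push_cast <;> omega)
    have c1 : ∑ a ∈ Finset.range n, ∑ b ∈ Finset.range n,
        (if (q : ℤ) - 2 * n + (a - b : ℤ) = 0 then (1 : ℂ) else 0) = ((n - (2 * n - q) : ℕ) : ℂ) := by
      rw [← card_filter_add n (2 * n - q), Finset.sum_comm]
      refine Finset.sum_congr rfl fun a _ => Finset.sum_congr rfl fun b _ => ?_
      congr 1; exact propext (by omega)
    have c2 : ∑ a ∈ Finset.range n, ∑ b ∈ Finset.range n,
        (if (q : ℤ) + (a - b : ℤ) = 0 then (1 : ℂ) else 0) = ((n - q : ℕ) : ℂ) := by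
      rw [← card_filter_add n q]
      refine Finset.sum_congr rfl fun a _ => Finset.sum_congr rfl fun b _ => ?_
      congr 1; exact propext (by omega)
    rw [c1] at s1
    rw [c2] at s2
    -- The truncated subtractions are the positive and negative parts of q - n.
    have key : ((n - (2 * n - q) : ℕ) : ℂ) - ((n - q : ℕ) : ℂ) = (q : ℂ) - n := by
      rcases le_total q n with h | h
      · rw [show n - (2 * n - q) = 0 by omega, Nat.cast_sub h]; simp
      · rw [show n - q = 0 by omega, show n - (2 * n - q) = q - n by omega, Nat.cast_sub h]; simp
    rw [← key]
    calc I * (p.coeff q * (((n - (2 * n - q) : ℕ) : ℂ) - ((n - q : ℕ) : ℂ)))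
        = ((3 * n : ℕ) : ℂ)⁻¹ * (I * p.coeff q) * (((3 * n : ℕ) : ℂ) * ((n - (2 * n - q) : ℕ) : ℂ) -
            ((3 * n : ℕ) : ℂ) * ((n - q : ℕ) : ℂ)) := by field_simp
      _ = _ := by
          rw [← s1, ← s2, ← Finset.sum_sub_distrib, Finset.mul_sum]
          refine Finset.sum_congr rfl fun l _ => ?_
          have e1 : (ζ ^ l) ^ ((q : ℤ) - 2 * n) =
              (ζ ^ l) ^ (-(n : ℤ)) * (ζ ^ l) ^ ((q : ℤ) - n) := by
            rw [← zpow_add₀ (hl0 l)]; congr 1; ring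
          have e2 : (ζ ^ l) ^ (q : ℤ) = (ζ ^ l) ^ (n : ℤ) * (ζ ^ l) ^ ((q : ℤ) - n) := by
            rw [← zpow_add₀ (hl0 l)]; congr 1; ring
          rw [e1, e2]; ring

end AlgApprox

namespace AlgApprox

/-! ### Archimedes' theorem for the unit ball of `ℝ × ℂ` -/

/-- Euclidean norm on `ℝ × ℂ`. -/
noncomputable def rad (q : ℝ × ℂ) : ℝ := Real.sqrt (q.1 ^ 2 + ‖q.2‖ ^ 2)

/-- Punctured open Euclidean unit ball of `ℝ × ℂ`. -/
def puncturedBall : Set (ℝ × ℂ) := {q | rad q ∈ Ioo (0 : ℝ) 1}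

lemma continuous_rad : Continuous rad := by unfold rad; fun_prop

lemma measurableSet_puncturedBall : MeasurableSet puncturedBall :=
  continuous_rad.measurable measurableSet_Ioo

lemma lintegral_comp_norm_complex (g : ℝ → ℝ≥0∞) (hg : Measurable g) :
    ∫⁻ ζ : ℂ, g ‖ζ‖ = ENNReal.ofReal (2 * Real.pi) *
      ∫⁻ ρ in Ioi (0 : ℝ), ENNReal.ofReal ρ * g ρ := by
  rw [← Complex.lintegral_comp_polarCoord_symm, polarCoord_target, Measure.volume_eq_prod,
    ← Measure.prod_restrict, lintegral_prod]
  · rw [← lintegral_const_mul _ (by fun_prop)]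
    refine setLIntegral_congr_fun measurableSet_Ioi fun ρ hρ => ?_
    have : ∀ y : ℝ, ENNReal.ofReal ρ • g ‖Complex.polarCoord.symm (ρ, y)‖
        = ENNReal.ofReal ρ * g ρ := by
      intro y
      rw [Complex.norm_polarCoord_symm, abs_of_pos hρ, smul_eq_mul]
    simp only [this, lintegral_const, Measure.restrict_apply MeasurableSet.univ, univ_inter,
      Real.volume_Ioo]
    rw [mul_comm]; congr 2; ring
  · simp only [Complex.norm_polarCoord_symm, smul_eq_mul]
    fun_prop

/-- With s² = z² + ρ² one has s ds = ρ dρ. The density s ds dz no longer depends on z, which is why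
the height is uniform on each sphere. -/
lemma lintegral_comp_sqrt_sq_add (z : ℝ) (g : ℝ → ℝ≥0∞) :
    ∫⁻ ρ in Ioi (0 : ℝ), ENNReal.ofReal ρ * g (Real.sqrt (z ^ 2 + ρ ^ 2)) =
      ∫⁻ s in Ioi |z|, ENNReal.ofReal s * g s := by
  have himg : (fun ρ : ℝ => Real.sqrt (z ^ 2 + ρ ^ 2)) '' Ioi 0 = Ioi |z| := by
    ext s
    simp only [mem_image, mem_Ioi]
    constructor
    · rintro ⟨ρ, hρ, rfl⟩
      rw [← Real.sqrt_sq_eq_abs]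
      exact Real.sqrt_lt_sqrt (sq_nonneg _) (by nlinarith)
    · intro hs
      have hs0 : 0 < s := (abs_nonneg z).trans_lt hs
      have : z ^ 2 < s ^ 2 := by rw [← sq_abs z]; nlinarith [abs_nonneg z]
      refine ⟨Real.sqrt (s ^ 2 - z ^ 2), Real.sqrt_pos.2 (by linarith), ?_⟩
      rw [Real.sq_sqrt (by linarith), add_sub_cancel, Real.sqrt_sq hs0.le]
  have hinj : InjOn (fun ρ : ℝ => Real.sqrt (z ^ 2 + ρ ^ 2)) (Ioi 0) := by
    intro a ha b hb hab
    have ha' : 0 < a := ha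
    have hb' : 0 < b := hb
    have h := (Real.sqrt_inj (by positivity) (by positivity)).1 hab
    exact (pow_left_inj₀ ha'.le hb'.le two_ne_zero).1 (by linarith)
  rw [← himg, lintegral_image_eq_lintegral_abs_deriv_mul (f' := fun ρ => ρ / √(z ^ 2 + ρ ^ 2))
    measurableSet_Ioi ?_ hinj]
  · refine setLIntegral_congr_fun measurableSet_Ioi fun ρ hρ => ?_
    have hρ' : 0 < ρ := hρ
    have hpos : 0 < √(z ^ 2 + ρ ^ 2) := Real.sqrt_pos.2 (by positivity)
    rw [← mul_assoc, ← ENNReal.ofReal_mul (abs_nonneg _), abs_of_pos (by positivity),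
      div_mul_cancel₀ _ hpos.ne']
  · intro ρ hρ
    have hρ' : 0 < ρ := hρ
    have h1 : HasDerivAt (fun ρ : ℝ => z ^ 2 + ρ ^ 2) (2 * ρ) ρ := by
      simpa using ((hasDerivAt_pow 2 ρ).const_add (z ^ 2))
    have h2 := h1.sqrt (by positivity)
    rw [mul_div_mul_left _ _ two_ne_zero] at h2
    exact h2.hasDerivWithinAt

lemma lintegral_comp_div (s : ℝ) (hs : 0 < s) (H : ℝ → ℝ≥0∞) :
    ∫⁻ z in Ioo (-s) s, H (z / s) = ENNReal.ofReal s * ∫⁻ u in Ioo (-1 : ℝ) 1, H u := by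
  have himg : (fun z : ℝ => z / s) '' Ioo (-s) s = Ioo (-1) 1 := by
    ext u
    simp only [mem_image, mem_Ioo]
    constructor
    · rintro ⟨z, ⟨h1, h2⟩, rfl⟩
      rw [lt_div_iff₀ hs, div_lt_iff₀ hs]
      constructor <;> linarith
    · rintro ⟨h1, h2⟩
      exact ⟨u * s, ⟨by nlinarith, by nlinarith⟩, by field_simp⟩
  rw [← himg, lintegral_image_eq_lintegral_abs_deriv_mul (f' := fun _ => s⁻¹) measurableSet_Ioo
    (fun x _ => by simpa [div_eq_mul_inv] using ((hasDerivAt_id x).mul_const s⁻¹).hasDerivWithinAt)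
    (fun a _ b _ h => by
      have h' : a / s = b / s := h
      exact (div_left_inj' hs.ne').1 h')]
  rw [abs_of_pos (inv_pos.2 hs), lintegral_const_mul' _ _ ENNReal.ofReal_ne_top, ← mul_assoc,
    ← ENNReal.ofReal_mul hs.le, mul_inv_cancel₀ hs.ne', ENNReal.ofReal_one, one_mul]

/-- The normalisation constant in `map_height_puncturedBall`. -/
noncomputable def ballConst : ℝ≥0∞ :=
  ENNReal.ofReal (2 * Real.pi) * ∫⁻ s in Ioo (0 : ℝ) 1, ENNReal.ofReal s * ENNReal.ofReal s

lemma ballConst_ne_zero : ballConst ≠ 0 := by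
  unfold ballConst
  refine mul_ne_zero (by simp [Real.pi_pos]) ?_
  rw [← pos_iff_ne_zero, setLIntegral_pos_iff (by fun_prop)]
  have : Function.support (fun s : ℝ => ENNReal.ofReal s * ENNReal.ofReal s) ∩ Ioo 0 1
      = Ioo 0 1 := by
    refine inter_eq_right.2 fun s hs => ?_
    simp [hs.1]
  rw [this]; simp

lemma ballConst_ne_top : ballConst ≠ ⊤ := by
  unfold ballConst
  refine ENNReal.mul_ne_top ENNReal.ofReal_ne_top (ne_of_lt ?_)
  calc _ ≤ ∫⁻ s in Ioo (0 : ℝ) 1, 1 := by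
        refine setLIntegral_mono measurable_const fun s hs => ?_
        have : ENNReal.ofReal s ≤ 1 := by simpa using hs.2.le
        exact mul_le_one' this this
    _ < ⊤ := by simp

lemma μI_eq_Ioo : μI = volume.restrict (Ioo (-1 : ℝ) 1) :=
  Measure.restrict_congr_set Ioo_ae_eq_Icc.symm

lemma lintegral_puncturedBall (H : ℝ → ℝ≥0∞) (hH : Measurable H) :
    ∫⁻ q in puncturedBall, H (q.1 / rad q) = ballConst * ∫⁻ u, H u ∂μI := by
  let K : ℝ → ℝ → ℝ≥0∞ := fun z s => (Ioo (0 : ℝ) 1).indicator (fun s => H (z / s)) s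
  have hK : Measurable (fun q : ℝ × ℝ => K q.1 q.2) := by
    have : (fun q : ℝ × ℝ => K q.1 q.2) =
        (Prod.snd ⁻¹' Ioo (0 : ℝ) 1).indicator (fun q : ℝ × ℝ => H (q.1 / q.2)) := rfl
    rw [this]
    exact Measurable.indicator (by fun_prop) (measurable_snd measurableSet_Ioo)
  have hKz : ∀ z, Measurable (K z) := fun z => hK.comp (measurable_const.prodMk measurable_id)
  have e0 : ∫⁻ q in puncturedBall, H (q.1 / rad q) = ∫⁻ q : ℝ × ℂ, K q.1 (rad q) := by
    rw [← lintegral_indicator measurableSet_puncturedBall]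
    rfl
  have hL : Measurable (fun q : ℝ × ℝ =>
      (Ioi |q.1|).indicator (fun s => ENNReal.ofReal s * K q.1 s) q.2) := by
    have : (fun q : ℝ × ℝ => (Ioi |q.1|).indicator (fun s => ENNReal.ofReal s * K q.1 s) q.2) =
        {q : ℝ × ℝ | |q.1| < q.2}.indicator (fun q => ENNReal.ofReal q.2 * K q.1 q.2) := rfl
    rw [this]
    refine Measurable.indicator (by fun_prop) ?_
    exact measurableSet_lt (by fun_prop) (by fun_prop)
  have e1 : ∀ z : ℝ, ∫⁻ ζ : ℂ, K z (rad (z, ζ)) = ENNReal.ofReal (2 * Real.pi) *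
      ∫⁻ s, (Ioi |z|).indicator (fun s => ENNReal.ofReal s * K z s) s := by
    intro z
    have := hKz z
    rw [lintegral_indicator measurableSet_Ioi, ← lintegral_comp_sqrt_sq_add,
      ← lintegral_comp_norm_complex (fun ρ => K z (√(z ^ 2 + ρ ^ 2))) (by fun_prop)]
    rfl
  have e2 : ∀ s : ℝ, ∫⁻ z, (Ioi |z|).indicator (fun s => ENNReal.ofReal s * K z s) s =
      (Ioo (0 : ℝ) 1).indicator (fun s => ENNReal.ofReal s * ENNReal.ofReal s *
        ∫⁻ u in Ioo (-1 : ℝ) 1, H u) s := by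
    intro s
    by_cases hs : s ∈ Ioo (0 : ℝ) 1
    · rw [indicator_of_mem hs, mul_assoc, ← lintegral_comp_div s hs.1,
        ← lintegral_const_mul' _ _ ENNReal.ofReal_ne_top, ← lintegral_indicator measurableSet_Ioo]
      refine lintegral_congr fun z => ?_
      by_cases hz : |z| < s
      · rw [indicator_of_mem (mem_Ioi.2 hz), indicator_of_mem (mem_Ioo.2 (abs_lt.1 hz))]
        simp only [K, indicator_of_mem hs]
      · rw [indicator_of_notMem (mt mem_Ioi.1 hz),
          indicator_of_notMem (fun h => hz (abs_lt.2 (mem_Ioo.1 h)))]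
    · rw [indicator_of_notMem hs]
      refine (lintegral_congr fun z => ?_).trans lintegral_zero
      refine indicator_apply_eq_zero.2 fun _ => ?_
      simp only [K, indicator_of_notMem hs, mul_zero]
  rw [e0, Measure.volume_eq_prod, lintegral_prod]
  · simp only [e1]
    rw [lintegral_const_mul' _ _ ENNReal.ofReal_ne_top, lintegral_lintegral_swap hL.aemeasurable]
    simp only [e2]
    rw [lintegral_indicator measurableSet_Ioo, lintegral_mul_const _ (by fun_prop), μI_eq_Ioo,
      ballConst, mul_assoc]
  · exact (hK.comp (measurable_fst.prodMk continuous_rad.measurable)).aemeasurable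

/-- The height of a uniformly distributed direction is uniformly distributed. -/
theorem map_height_puncturedBall :
    Measure.map (fun q => q.1 / rad q) (volume.restrict puncturedBall) = ballConst • μI := by
  have hm : Measurable (fun q : ℝ × ℂ => q.1 / rad q) :=
    measurable_fst.div continuous_rad.measurable
  refine Measure.ext_of_lintegral _ fun H hH => ?_
  rw [lintegral_map hH hm, lintegral_puncturedBall H hH, lintegral_smul_measure, smul_eq_mul]

end AlgApprox

namespace AlgApprox

/-! ### The Bernstein inequality in `L_p` -/

/-- The product carries the sup norm, so `A` is seen as an isometry of `WithLp 2 (ℝ × ℂ)`, whose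
volume corresponds to the product volume. -/
lemma measurePreserving_of_rad (A : ℝ × ℂ →ₗ[ℝ] ℝ × ℂ) (hA : ∀ q, rad (A q) = rad q) :
    MeasurePreserving A volume volume := by
  let e := WithLp.linearEquiv 2 ℝ (ℝ × ℂ)
  let B : WithLp 2 (ℝ × ℂ) →ₗᵢ[ℝ] WithLp 2 (ℝ × ℂ) :=
    { toLinearMap := e.symm.toLinearMap ∘ₗ A ∘ₗ e.toLinearMap
      norm_map' := fun x => by
        have h := hA (e x)
        simp only [rad] at h
        simp only [WithLp.prod_norm_eq_of_L2]
        have hx : ∀ r : ℝ, ‖r‖ ^ 2 = r ^ 2 := fun r => by rw [Real.norm_eq_abs, sq_abs]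
        simp only [hx]
        exact h }
  have hB : MeasurePreserving B volume volume :=
    (B.toLinearIsometryEquiv rfl).measurePreserving
  exact (WithLp.volume_preserving_ofLp ℝ ℂ).comp (hB.comp (WithLp.volume_preserving_toLp ℝ ℂ))

/-- Rotation of `ℝ × ℂ` mixing the height with the real part. -/
noncomputable def rotRe (t : ℝ) : ℝ × ℂ →ₗ[ℝ] ℝ × ℂ where
  toFun q := (q.1 * Real.cos t - q.2.re * Real.sin t,
    ⟨q.2.re * Real.cos t + q.1 * Real.sin t, q.2.im⟩)
  map_add' a b := Prod.ext (by simp; ring)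
    (Complex.ext (by simp; try ring) (by simp; try ring))
  map_smul' c a := Prod.ext (by simp; ring)
    (Complex.ext (by simp; try ring) (by simp; try ring))

/-- Rotation of `ℝ × ℂ` mixing the height with the imaginary part. -/
noncomputable def rotIm (t : ℝ) : ℝ × ℂ →ₗ[ℝ] ℝ × ℂ where
  toFun q := (q.1 * Real.cos t - q.2.im * Real.sin t,
    ⟨q.2.re, q.2.im * Real.cos t + q.1 * Real.sin t⟩)
  map_add' a b := Prod.ext (by simp; ring)
    (Complex.ext (by simp; try ring) (by simp; try ring))
  map_smul' c a := Prod.ext (by simp; ring)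
    (Complex.ext (by simp; try ring) (by simp; try ring))

lemma rad_rotRe (t : ℝ) (q : ℝ × ℂ) : rad (rotRe t q) = rad q := by
  simp only [rad, rotRe, Complex.sq_norm, Complex.normSq_apply, LinearMap.coe_mk, AddHom.coe_mk]
  congr 1
  linear_combination (q.1 ^ 2 + q.2.re ^ 2) * Real.sin_sq_add_cos_sq t

lemma rad_rotIm (t : ℝ) (q : ℝ × ℂ) : rad (rotIm t q) = rad q := by
  simp only [rad, rotIm, Complex.sq_norm, Complex.normSq_apply, LinearMap.coe_mk, AddHom.coe_mk]
  congr 1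
  linear_combination (q.1 ^ 2 + q.2.im ^ 2) * Real.sin_sq_add_cos_sq t

lemma measurePreserving_puncturedBall (A : ℝ × ℂ →ₗ[ℝ] ℝ × ℂ) (hA : ∀ q, rad (A q) = rad q) :
    MeasurePreserving A (volume.restrict puncturedBall) (volume.restrict puncturedBall) := by
  have h := (measurePreserving_of_rad A hA).restrict_preimage measurableSet_puncturedBall
  have : A ⁻¹' puncturedBall = puncturedBall := by
    ext q
    simp only [puncturedBall, mem_preimage, mem_ofPred_eq, hA]
  rwa [this] at h

lemma hasDerivAt_cos_sin (a b c : ℂ) :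
    HasDerivAt (fun t : ℝ => a * Real.cos t + b * Real.sin t + c) b 0 := by
  have h1 : HasDerivAt (fun t : ℝ => ((Real.cos t : ℝ) : ℂ)) ((-Real.sin 0 : ℝ) : ℂ) 0 :=
    (Real.hasDerivAt_cos 0).ofReal_comp
  have h2 : HasDerivAt (fun t : ℝ => ((Real.sin t : ℝ) : ℂ)) ((Real.cos 0 : ℝ) : ℂ) 0 :=
    (Real.hasDerivAt_sin 0).ofReal_comp
  simpa using ((h1.const_mul a).add (h2.const_mul b)).add_const c

/-- The function `S(z) (x + iy)^m` on the sphere, extended by homogeneity of degree `0`. -/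
noncomputable def sphFun (S : Polynomial ℂ) (m : ℕ) (q : ℝ × ℂ) : ℂ :=
  S.eval ((q.1 / rad q : ℝ) : ℂ) * (q.2 / (rad q : ℂ)) ^ m

lemma measurable_sphFun (S : Polynomial ℂ) (m : ℕ) : Measurable (sphFun S m) := by
  have h1 : Measurable (fun q : ℝ × ℂ => ((q.1 / rad q : ℝ) : ℂ)) :=
    Complex.measurable_ofReal.comp (measurable_fst.div continuous_rad.measurable)
  have h2 : Measurable (fun q : ℝ × ℂ => q.2 / (rad q : ℂ)) :=
    measurable_snd.div (Complex.measurable_ofReal.comp continuous_rad.measurable)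
  exact (S.continuous.measurable.comp h1).mul (h2.pow_const m)

lemma deriv_trig_prod (S : Polynomial ℂ) (m : ℕ) (a b c a' b' c' : ℂ) :
    HasDerivAt (fun t : ℝ => S.eval (a * Real.cos t + b * Real.sin t + c) *
        (a' * Real.cos t + b' * Real.sin t + c') ^ m)
      (S.derivative.eval (a + c) * b * (a' + c') ^ m +
        S.eval (a + c) * (m * (a' + c') ^ (m - 1) * b')) 0 := by
  have h1 := hasDerivAt_cos_sin a b c
  have h2 := hasDerivAt_cos_sin a' b' c'
  have h3 := (S.hasDerivAt (a * Real.cos 0 + b * Real.sin 0 + c)).comp (0 : ℝ) h1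
  have h4 := h3.fun_mul (h2.fun_pow m)
  exact h4.congr_deriv (by simp)

/-- The two infinitesimal rotations, added with weights 1 and i, form a ladder operator: the terms
from differentiating (x + iy)^m are proportional to z + i²z and cancel, leaving -S'(z)(x +
iy)^(m+1). -/
lemma sphFun_derivative_eq (S : Polynomial ℂ) (m n : ℕ) (hmn : S.natDegree + m ≤ n)
    (N : ℕ) (τ : ℕ → ℝ) (c : ℕ → ℂ)
    (hc : ∀ T : ℝ → ℂ, IsTrig n T → ∀ d : ℂ, HasDerivAt T d 0 →
        d = ∑ l ∈ Finset.range N, c l * T (τ l)) (q : ℝ × ℂ) :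
    sphFun S.derivative (m + 1) q = -(∑ l ∈ Finset.range N, c l * sphFun S m (rotRe (τ l) q) +
      Complex.I * ∑ l ∈ Finset.range N, c l * sphFun S m (rotIm (τ l) q)) := by
  set R : ℂ := (rad q : ℂ) with hR
  set z : ℂ := (q.1 : ℂ) / R with hz
  set x : ℂ := (q.2.re : ℂ) / R with hx
  set y : ℂ := (q.2.im : ℂ) / R with hy
  have hX : q.2 / R = x + Complex.I * y := by
    conv_lhs => rw [← Complex.re_add_im q.2]
    rw [hx, hy]; ring
  have e1 : ∀ t : ℝ, sphFun S m (rotRe t q) = S.eval (z * Real.cos t + (-x) * Real.sin t + 0) *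
      (x * Real.cos t + z * Real.sin t + Complex.I * y) ^ m := by
    intro t
    have h2 : (rotRe t q).2 = (q.2.re * Real.cos t + q.1 * Real.sin t) + q.2.im * Complex.I := by
      apply Complex.ext <;> simp [rotRe, -Complex.ofReal_cos, -Complex.ofReal_sin]
    rw [sphFun, rad_rotRe, h2]
    simp only [rotRe, LinearMap.coe_mk, AddHom.coe_mk]
    push_cast
    rw [← hR, hx, hy, hz]
    congr 2 <;> ring
  have e2 : ∀ t : ℝ, sphFun S m (rotIm t q) = S.eval (z * Real.cos t + (-y) * Real.sin t + 0) *
      ((Complex.I * y) * Real.cos t + (Complex.I * z) * Real.sin t + x) ^ m := by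
    intro t
    have h2 : (rotIm t q).2 = q.2.re + (q.2.im * Real.cos t + q.1 * Real.sin t) * Complex.I := by
      apply Complex.ext <;> simp [rotIm, -Complex.ofReal_cos, -Complex.ofReal_sin]
    rw [sphFun, rad_rotIm, h2]
    simp only [rotIm, LinearMap.coe_mk, AddHom.coe_mk]
    push_cast
    rw [← hR, hx, hy, hz]
    congr 2 <;> ring
  have t1 := hc _ (((isTrig_cos_sin z (-x) 0).eval S).mul
    ((isTrig_cos_sin x z (Complex.I * y)).pow m) |>.mono (by omega)) _ (deriv_trig_prod S m _ _ _ _ _ _)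
  have t2 := hc _ (((isTrig_cos_sin z (-y) 0).eval S).mul
    ((isTrig_cos_sin (Complex.I * y) (Complex.I * z) x).pow m) |>.mono (by omega)) _
    (deriv_trig_prod S m _ _ _ _ _ _)
  simp only [e1, e2]
  rw [← t1, ← t2, sphFun, ← hR, hX]
  push_cast
  rw [← hR, ← hz, add_comm (Complex.I * y) x, add_zero, pow_succ]
  linear_combination (S.eval z * m * (x + Complex.I * y) ^ (m - 1) * z) * Complex.I_sq

lemma norm_sphFun (S : Polynomial ℝ) (m : ℕ) {q : ℝ × ℂ} (hq : q ∈ puncturedBall) :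
    ‖sphFun (S.map (algebraMap ℝ ℂ)) m q‖ =
      ‖phi (q.1 / rad q) ^ m * S.eval (q.1 / rad q)‖ := by
  have hR : 0 < rad q := hq.1
  have hphi : phi (q.1 / rad q) = ‖q.2‖ / rad q := by
    have h2 : rad q ^ 2 = q.1 ^ 2 + ‖q.2‖ ^ 2 := Real.sq_sqrt (by positivity)
    rw [phi, Real.sqrt_eq_iff_mul_self_eq _ (by positivity)]
    · field_simp; linarith
    · rw [sub_nonneg, div_pow, div_le_one (by positivity), h2]
      nlinarith [sq_nonneg ‖q.2‖]
  have h3 : (S.map (algebraMap ℝ ℂ)).eval ((q.1 / rad q : ℝ) : ℂ) =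
      ((S.eval (q.1 / rad q) : ℝ) : ℂ) := by
    rw [Polynomial.eval_map_algebraMap]
    exact Polynomial.aeval_ofReal S (q.1 / rad q)
  rw [sphFun, h3, norm_mul, norm_mul, hphi, norm_pow, norm_pow, norm_div, norm_div, norm_norm,
    Complex.norm_real, Complex.norm_real, mul_comm]

/-- Push forward by the height. The factor is nonzero and finite for every p, hence cancels when two
such norms are compared. -/
lemma eLpNorm_sphFun (p : ℝ≥0∞) (S : Polynomial ℝ) (m : ℕ) :
    eLpNorm (sphFun (S.map (algebraMap ℝ ℂ)) m) p (volume.restrict puncturedBall) =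
      ballConst ^ (1 / p).toReal * eLpNorm (fun x => phi x ^ m * S.eval x) p μI := by
  have hc : Continuous (fun x => phi x ^ m * S.eval x) := by
    have := S.continuous
    unfold phi
    fun_prop
  have hm : Measurable (fun q : ℝ × ℂ => q.1 / rad q) :=
    measurable_fst.div continuous_rad.measurable
  rw [← smul_eq_mul, ← eLpNorm_smul_measure_of_ne_zero ballConst_ne_zero,
    ← map_height_puncturedBall, eLpNorm_map_measure hc.aestronglyMeasurable hm.aemeasurable]
  refine eLpNorm_congr_norm_ae ?_
  filter_upwards [ae_restrict_mem measurableSet_puncturedBall] with q hq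
  exact norm_sphFun S m hq

/-- One step of the weighted Bernstein inequality in `L_p[-1, 1]`. -/
theorem eLpNorm_phi_derivative_le (p : ℝ≥0∞) (hp : 1 ≤ p) (S : Polynomial ℝ) (m n : ℕ)
    (hn : 1 ≤ n) (hmn : S.natDegree + m ≤ n) :
    eLpNorm (fun x => phi x ^ (m + 1) * S.derivative.eval x) p μI ≤
      ENNReal.ofReal (4 * n) * eLpNorm (fun x => phi x ^ m * S.eval x) p μI := by
  obtain ⟨c, hcn, hc⟩ := exists_trig_interpolation n hn
  set ν := volume.restrict puncturedBall
  set F := sphFun (S.map (algebraMap ℝ ℂ)) m with hF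
  have hrot : ∀ A : ℝ × ℂ →ₗ[ℝ] ℝ × ℂ, (∀ q, rad (A q) = rad q) →
      eLpNorm (fun q => F (A q)) p ν = eLpNorm F p ν ∧
      AEStronglyMeasurable (fun q => F (A q)) ν := by
    intro A hA
    have hAm := measurePreserving_puncturedBall A hA
    have hFm := measurable_sphFun (S.map (algebraMap ℝ ℂ)) m
    rw [hF]
    exact ⟨eLpNorm_comp_measurePreserving (g := sphFun (S.map (algebraMap ℝ ℂ)) m)
      hFm.aestronglyMeasurable hAm, (hFm.comp hAm.measurable).aestronglyMeasurable⟩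
  have hsum : ∀ A : ℕ → ℝ × ℂ →ₗ[ℝ] ℝ × ℂ, (∀ l q, rad (A l q) = rad q) →
      eLpNorm (fun q => ∑ l ∈ Finset.range (3 * n), c l * F (A l q)) p ν ≤
        ENNReal.ofReal (2 * n) * eLpNorm F p ν ∧
      AEStronglyMeasurable (fun q => ∑ l ∈ Finset.range (3 * n), c l * F (A l q)) ν := by
    intro A hA
    have hm : ∀ l, AEStronglyMeasurable (fun q => c l * F (A l q)) ν :=
      fun l => (hrot (A l) (hA l)).2.const_mul (c l)
    have hfun : (fun q => ∑ l ∈ Finset.range (3 * n), c l * F (A l q)) =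
        ∑ l ∈ Finset.range (3 * n), fun q => c l * F (A l q) := by
      ext q; simp
    rw [hfun]
    refine ⟨(eLpNorm_sum_le (fun l _ => hm l) hp).trans ?_,
      Finset.aestronglyMeasurable_sum _ fun l _ => hm l⟩
    calc _ = ∑ l ∈ Finset.range (3 * n), ENNReal.ofReal ‖c l‖ * eLpNorm F p ν := by
          refine Finset.sum_congr rfl fun l _ => ?_
          have := eLpNorm_const_smul (c l) (fun q => F (A l q)) p ν
          rw [(hrot (A l) (hA l)).1] at this
          rw [ofReal_norm, ← this]
          rfl
      _ ≤ _ := by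
          rw [← Finset.sum_mul, ← ENNReal.ofReal_sum_of_nonneg (fun _ _ => norm_nonneg _)]
          gcongr
  have h1 := hsum (fun l => rotRe (2 * Real.pi * l / (3 * n : ℕ))) (fun l => rad_rotRe _)
  have h2 := hsum (fun l => rotIm (2 * Real.pi * l / (3 * n : ℕ))) (fun l => rad_rotIm _)
  have hG : eLpNorm (sphFun (S.derivative.map (algebraMap ℝ ℂ)) (m + 1)) p ν ≤
      ENNReal.ofReal (4 * n) * eLpNorm F p ν := by
    have heq := sphFun_derivative_eq (S.map (algebraMap ℝ ℂ)) m n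
      (by rwa [Polynomial.natDegree_map]) _ _ c hc
    rw [Polynomial.derivative_map] at heq
    rw [show sphFun (S.derivative.map (algebraMap ℝ ℂ)) (m + 1) = _ from funext heq]
    refine (eLpNorm_neg _ p ν).le.trans ?_
    refine (eLpNorm_add_le h1.2 (h2.2.const_mul _) hp).trans ?_
    have h3 := eLpNorm_const_smul Complex.I (fun q => ∑ l ∈ Finset.range (3 * n),
      c l * F (rotIm (2 * Real.pi * l / (3 * n : ℕ)) q)) p ν
    have hI : ‖Complex.I‖ₑ = 1 := by
      rw [← ofReal_norm, Complex.norm_I, ENNReal.ofReal_one]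
    rw [hI, one_mul] at h3
    calc _ ≤ ENNReal.ofReal (2 * n) * eLpNorm F p ν + ENNReal.ofReal (2 * n) * eLpNorm F p ν :=
          add_le_add h1.1 (h3.le.trans h2.1)
      _ = _ := by
          rw [← add_mul, ← ENNReal.ofReal_add (by positivity) (by positivity)]
          congr 2; ring
  rw [eLpNorm_sphFun, hF, eLpNorm_sphFun, mul_left_comm] at hG
  refine (ENNReal.mul_le_mul_iff_right ?_ ?_).1 hG
  · exact (ENNReal.rpow_pos (pos_iff_ne_zero.2 ballConst_ne_zero) ballConst_ne_top).ne'
  · exact ENNReal.rpow_ne_top_of_nonneg ENNReal.toReal_nonneg ballConst_ne_top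

/-- The Bernstein inequality in `L_p[-1, 1]`. -/
theorem bernstein (p : ℝ≥0∞) (hp : 1 ≤ p) (Q : Polynomial ℝ) (n : ℕ)
    (hQ : Q.degree < n) (r : ℕ) :
    eLpNorm (fun x => phi x ^ r * (Polynomial.derivative^[r] Q).eval x) p μI ≤
      ENNReal.ofReal ((4 * n) ^ r) * eLpNorm (fun x => Q.eval x) p μI := by
  induction r with
  | zero => simp
  | succ r ih =>
    rw [Function.iterate_succ_apply']
    by_cases h0 : Polynomial.derivative (Polynomial.derivative^[r] Q) = 0
    · simp [h0]
    have hQ0 : Q ≠ 0 := by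
      rintro rfl
      simp at h0
    have hlt : Q.natDegree < n := (Polynomial.natDegree_lt_iff_degree_lt hQ0).2 hQ
    -- Each derivative lowers the degree by one while the weight exponent rises by one, so the
    -- spherical degree stays at most n and every step costs the same factor 4n.
    have hd : (Polynomial.derivative^[r] Q).natDegree + r ≤ n := by
      have h1 := Polynomial.natDegree_iterate_derivative Q r
      have h2 : r ≤ Q.natDegree := by
        by_contra hlt'
        rw [not_le] at hlt'
        rw [Polynomial.iterate_derivative_eq_zero hlt'] at h0
        simp at h0
      omega
    refine (eLpNorm_phi_derivative_le p hp _ r n (by omega) hd).trans ?_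
    rw [pow_succ', ENNReal.ofReal_mul (p := 4 * (n : ℝ)) (by positivity), mul_assoc]
    exact mul_le_mul_right ih _

end AlgApprox

namespace AlgApprox

/-! ### The change of variables `x ↦ x + c φ(x)` -/

lemma continuous_phi : Continuous phi := by unfold phi; fun_prop

lemma phi_nonneg (x : ℝ) : 0 ≤ phi x := Real.sqrt_nonneg _

lemma phi_sq {x : ℝ} (hx : x ∈ Icc (-1 : ℝ) 1) : phi x ^ 2 = (1 - x) * (1 + x) := by
  rw [phi, Real.sq_sqrt (by nlinarith [hx.1, hx.2])]; ring

lemma phi_pos {x : ℝ} (hx : x ∈ Ioo (-1 : ℝ) 1) : 0 < phi x :=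
  Real.sqrt_pos.2 (by nlinarith [hx.1, hx.2])

lemma hasDerivAt_phi {x : ℝ} (hx : x ∈ Ioo (-1 : ℝ) 1) : HasDerivAt phi (-x / phi x) x := by
  have h1 : HasDerivAt (fun x : ℝ => 1 - x ^ 2) (-(2 * x)) x := by
    simpa using (hasDerivAt_pow 2 x).const_sub 1
  have h2 := h1.sqrt (by nlinarith [hx.1, hx.2])
  rw [← mul_neg, mul_div_mul_left _ _ two_ne_zero] at h2
  exact h2

/-- Points of `(-1, 1)` at which the difference with half-width `d φ(x)` fits in `[-1, 1]`. -/
def diffDom (d : ℝ) : Set ℝ :=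
  {x | x ∈ Ioo (-1 : ℝ) 1 ∧ x - d * phi x ∈ Icc (-1 : ℝ) 1 ∧ x + d * phi x ∈ Icc (-1 : ℝ) 1}

lemma measurableSet_diffDom (d : ℝ) : MeasurableSet (diffDom d) := by
  have h1 : Measurable (fun x => x - d * phi x) := by have := continuous_phi; fun_prop
  have h2 : Measurable (fun x => x + d * phi x) := by have := continuous_phi; fun_prop
  exact measurableSet_Ioo.inter ((h1 measurableSet_Icc).inter (h2 measurableSet_Icc))

lemma diffDom_subset (d : ℝ) : diffDom d ⊆ Icc (-1) 1 := fun _ hx => Ioo_subset_Icc_self hx.1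

/-- Multiply dφ ≤ 1 - x by 1 + x and divide by φ, using φ² = (1 - x)(1 + x); symmetrically at the
other endpoint. -/
lemma le_phi_of_mem_diffDom {d x : ℝ} (hx : x ∈ diffDom d) :
    d * (1 + x) ≤ phi x ∧ d * (1 - x) ≤ phi x := by
  obtain ⟨h0, h1, h2⟩ := hx
  have hp := phi_pos h0
  have hs := phi_sq (Ioo_subset_Icc_self h0)
  constructor
  · by_contra! h
    have : phi x * phi x < phi x * (d * (1 + x)) := by gcongr
    nlinarith [h2.2, h0.1]
  · by_contra! h
    have : phi x * phi x < phi x * (d * (1 - x)) := by gcongr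
    nlinarith [h1.1, h0.2]

lemma le_one_of_mem_diffDom {d x : ℝ} (hx : x ∈ diffDom d) : d ≤ 1 := by
  have h := le_phi_of_mem_diffDom hx
  have : phi x ≤ 1 := Real.sqrt_le_one.2 (by nlinarith [sq_nonneg x])
  linarith

lemma two_mul_abs_le_phi {d c x : ℝ} (hc : |c| ≤ d) (hx : x ∈ diffDom d) :
    2 * |c * x| ≤ phi x := by
  have h := le_phi_of_mem_diffDom hx
  have hd : 0 ≤ d := (abs_nonneg c).trans hc
  have h1 := hx.1.1
  have h2 := hx.1.2
  have h3 : |c * x| ≤ d * |x| := by rw [abs_mul]; gcongr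
  rcases abs_cases x with ⟨hx', _⟩ | ⟨hx', _⟩ <;> rw [hx'] at h3 <;> nlinarith

lemma shift_mem_Icc {d c x : ℝ} (hc : |c| ≤ d) (hx : x ∈ diffDom d) :
    x + c * phi x ∈ Icc (-1 : ℝ) 1 := by
  have hp := phi_nonneg x
  obtain ⟨h1, h2⟩ := abs_le.1 hc
  have h3 := hx.2.1.1
  have h4 := hx.2.2.2
  constructor <;> nlinarith

/-- If x and y have the same image, then (y - x)(φ(x) + φ(y) - c(x + y)) = 0, and the second factor
is positive since cx ≤ φ(x)/2 and cy ≤ φ(y)/2. -/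
lemma injOn_shift {d c : ℝ} (hc : |c| ≤ d) : InjOn (fun x => x + c * phi x) (diffDom d) := by
  intro x hx y hy hxy
  by_contra hne
  have hxy' : x + c * phi x = y + c * phi y := hxy
  have h1 := phi_sq (diffDom_subset d hx)
  have h2 := phi_sq (diffDom_subset d hy)
  have h3 := two_mul_abs_le_phi hc hx
  have h4 := two_mul_abs_le_phi hc hy
  have h5 := phi_pos hx.1
  have h6 := phi_pos hy.1
  have h7 : (y - x) * (phi x + phi y - c * (x + y)) = 0 := by
    linear_combination (-(phi x + phi y)) * hxy' + c * h1 - c * h2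
  have h8 := (mul_eq_zero.1 h7).resolve_left (sub_ne_zero.2 (Ne.symm hne))
  have h9 := le_abs_self (c * x)
  have h10 := le_abs_self (c * y)
  linarith

lemma continuous_shift (c : ℝ) : Continuous (fun x => x + c * phi x) := by
  have := continuous_phi
  fun_prop

/-- The map is injective with derivative 1 - cx/φ(x) ≥ 1/2, so it at most halves volumes. The
constant 2 does not depend on c or d. -/
theorem map_shift_le {d c : ℝ} (hc : |c| ≤ d) :
    Measure.map (fun x => x + c * phi x) (volume.restrict (diffDom d)) ≤ (2 : ℝ≥0∞) • μI := by
  refine Measure.le_iff.2 fun A hA => ?_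
  have hm := (continuous_shift c).measurable
  rw [Measure.map_apply hm hA, Measure.restrict_apply (hm hA), Measure.smul_apply, smul_eq_mul,
    μI, Measure.restrict_apply hA]
  set S := (fun x => x + c * phi x) ⁻¹' A ∩ diffDom d with hS
  have hSm : MeasurableSet S := (hm hA).inter (measurableSet_diffDom d)
  have hder : ∀ x ∈ S, HasDerivWithinAt (fun x => x + c * phi x) (1 + c * (-x / phi x)) S x :=
    fun x hx => ((hasDerivAt_id x).add
      ((hasDerivAt_phi hx.2.1).const_mul c)).hasDerivWithinAt
  have himg := lintegral_image_eq_lintegral_abs_deriv_mul hSm hder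
    ((injOn_shift hc).mono inter_subset_right) 1
  simp only [Pi.one_apply, lintegral_one, Measure.restrict_apply MeasurableSet.univ, univ_inter,
    mul_one] at himg
  have hlow : ENNReal.ofReal (1 / 2) * volume S ≤
      volume ((fun x => x + c * phi x) '' S) := by
    rw [himg, ← setLIntegral_const]
    refine setLIntegral_mono' hSm fun x hx => ENNReal.ofReal_le_ofReal ?_
    have h1 := two_mul_abs_le_phi hc hx.2
    have h2 := phi_pos hx.2.1
    have h3 := le_abs_self (c * x)
    refine le_trans ?_ (le_abs_self _)
    have : c * (-x / phi x) = -(c * x / phi x) := by ring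
    rw [this]
    have : c * x / phi x ≤ 1 / 2 := by rw [div_le_iff₀ h2]; linarith
    linarith
  have hsub : (fun x => x + c * phi x) '' S ⊆ A ∩ Icc (-1) 1 := by
    rintro _ ⟨x, hx, rfl⟩
    exact ⟨hx.1, shift_mem_Icc hc hx.2⟩
  calc volume S = 2 * (ENNReal.ofReal (1 / 2) * volume S) := by
        rw [← mul_assoc, one_div, ENNReal.ofReal_inv_of_pos two_pos, ENNReal.ofReal_ofNat,
          ENNReal.mul_inv_cancel two_ne_zero ENNReal.ofNat_ne_top, one_mul]
    _ ≤ 2 * volume (A ∩ Icc (-1) 1) := by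
        gcongr
        exact hlow.trans (measure_mono hsub)

lemma eLpNorm_comp_shift_le {d c : ℝ} (hc : |c| ≤ d) {p : ℝ≥0∞} (hp : 1 ≤ p) {G : ℝ → ℝ}
    (hG : Continuous G) :
    eLpNorm (fun x => G (x + c * phi x)) p (volume.restrict (diffDom d)) ≤
      2 * eLpNorm G p μI := by
  have h1 := eLpNorm_map_measure (p := p) (f := fun x => x + c * phi x)
    (μ := volume.restrict (diffDom d)) (g := G) hG.aestronglyMeasurable
    (continuous_shift c).aemeasurable
  refine h1.symm.le.trans ((eLpNorm_mono_measure _ (map_shift_le hc)).trans ?_)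
  rw [eLpNorm_smul_measure_of_ne_zero two_ne_zero, smul_eq_mul]
  gcongr
  calc (2 : ℝ≥0∞) ^ (1 / p).toReal ≤ 2 ^ (1 : ℝ) := by
        refine ENNReal.rpow_le_rpow_of_exponent_le (by norm_num) ?_
        refine ENNReal.toReal_le_of_le_ofReal zero_le_one ?_
        rw [ENNReal.ofReal_one, one_div]
        exact ENNReal.inv_le_one.2 hp
    _ = 2 := ENNReal.rpow_one _

/-- Both factors under the root of `wt` are distances to ±1 diminished by the largest admissible
shift. This lets the weight move to every node of the difference. -/
lemma wt_le_phi_shift {δ c x : ℝ} (hc : |c| ≤ δ / 2) (hx : x ∈ diffDom (δ / 2)) :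
    wt δ x ≤ phi (x + c * phi x) := by
  obtain ⟨h1, h2⟩ := abs_le.1 hc
  have hp := phi_nonneg x
  have h3 := hx.2.1.1
  have h4 := hx.2.2.2
  unfold wt
  rw [phi.eq_def (x + c * phi x)]
  refine Real.sqrt_le_sqrt ?_
  have a1 : 0 ≤ 1 - x - δ * phi x / 2 := by linarith
  have a2 : 0 ≤ 1 + x - δ * phi x / 2 := by linarith
  have b1 : 1 - x - δ * phi x / 2 ≤ 1 - (x + c * phi x) := by nlinarith
  have b2 : 1 + x - δ * phi x / 2 ≤ 1 + (x + c * phi x) := by nlinarith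
  calc _ ≤ (1 - (x + c * phi x)) * (1 + (x + c * phi x)) := mul_le_mul b1 b2 a2 (a1.trans b1)
    _ = _ := by ring

lemma wt_nonneg (δ x : ℝ) : 0 ≤ wt δ x := Real.sqrt_nonneg _

lemma continuous_wt (δ : ℝ) : Continuous (wt δ) := by
  have := continuous_phi
  unfold wt
  fun_prop

/-- `σ φ(x) ≤ φ(u)` for `u` between `x` and a point of `[-1, 1]`. -/
lemma mul_phi_le_phi {x y σ : ℝ} (hx : x ∈ Icc (-1 : ℝ) 1) (hy : y ∈ Icc (-1 : ℝ) 1)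
    (hσ : σ ∈ Icc (0 : ℝ) 1) : σ * phi x ≤ phi (y + (x - y) * σ ^ 2) := by
  refine Real.le_sqrt_of_sq_le ?_
  rw [mul_pow, phi_sq hx]
  have h1 : σ ^ 2 ≤ 1 := by nlinarith [hσ.1, hσ.2]
  have h2 : y ^ 2 ≤ 1 := by nlinarith [hy.1, hy.2]
  -- Concavity of 1 - x²: at the intermediate point it exceeds σ²(1 - x²) + (1 - σ²)(1 - y²) by σ²(1
  -- - σ²)(x - y)².
  nlinarith [mul_nonneg (mul_nonneg (sq_nonneg σ) (sub_nonneg.2 h1)) (sq_nonneg (x - y)),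
    mul_nonneg (sub_nonneg.2 h1) (sub_nonneg.2 h2)]

/-! ### Minkowski's integral inequality -/

/-- Since ν is a probability measure, Jensen's inequality at each x followed by Tonelli is enough
for finite p; p = ∞ only exchanges two almost-everywhere quantifiers. -/
theorem eLpNorm_integral_le {μ ν : Measure ℝ} [SFinite μ] [IsProbabilityMeasure ν]
    {p : ℝ≥0∞} (hp : 1 ≤ p) {u : ℝ → ℝ → ℝ} (hu : Continuous (Function.uncurry u)) {M : ℝ≥0∞}
    (hM : ∀ᵐ σ ∂ν, eLpNorm (fun x => u x σ) p μ ≤ M) :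
    eLpNorm (fun x => ∫ σ, u x σ ∂ν) p μ ≤ M := by
  have hp0 : p ≠ 0 := (zero_lt_one.trans_le hp).ne'
  have hux : ∀ x, Continuous (u x) := fun x => hu.comp (by fun_prop : Continuous (fun σ => (x, σ)))
  by_cases hpt : p = ⊤
  · subst hpt
    simp only [eLpNorm_exponent_top] at hM ⊢
    have h1 : ∀ᵐ σ ∂ν, ∀ᵐ x ∂μ, ‖u x σ‖ₑ ≤ M := by
      filter_upwards [hM] with σ hσ
      filter_upwards [enorm_ae_le_eLpNormEssSup (fun x => u x σ) μ] with x hx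
      exact hx.trans hσ
    have h2 : ∀ᵐ x ∂μ, ∀ᵐ σ ∂ν, ‖u x σ‖ₑ ≤ M := by
      refine (Measure.ae_ae_comm (p := fun x σ => ‖u x σ‖ₑ ≤ M) ?_).2 h1
      exact measurableSet_le hu.enorm.measurable measurable_const
    refine eLpNormEssSup_le_of_ae_enorm_bound ?_
    filter_upwards [h2] with x hx
    calc ‖∫ σ, u x σ ∂ν‖ₑ ≤ ∫⁻ σ, ‖u x σ‖ₑ ∂ν := enorm_integral_le_lintegral_enorm _
      _ ≤ ∫⁻ _, M ∂ν := lintegral_mono_ae hx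
      _ = M := by simp
  · have hp' : 0 < p.toReal := ENNReal.toReal_pos hp0 hpt
    have key : ∀ {f : ℝ → ℝ} {κ : Measure ℝ},
        eLpNorm f p κ ^ p.toReal = ∫⁻ x, ‖f x‖ₑ ^ p.toReal ∂κ := by
      intro f κ
      rw [eLpNorm_eq_lintegral_rpow_enorm_toReal hp0 hpt, ← ENNReal.rpow_mul,
        one_div_mul_cancel hp'.ne', ENNReal.rpow_one]
    rw [← ENNReal.rpow_le_rpow_iff hp', key]
    calc ∫⁻ x, ‖∫ σ, u x σ ∂ν‖ₑ ^ p.toReal ∂μ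
        ≤ ∫⁻ x, ∫⁻ σ, ‖u x σ‖ₑ ^ p.toReal ∂ν ∂μ := by
          refine lintegral_mono fun x => ?_
          rw [← key]
          gcongr
          refine (enorm_integral_le_lintegral_enorm _).trans ?_
          rw [← eLpNorm_one_eq_lintegral_enorm]
          exact eLpNorm_le_eLpNorm_of_exponent_le hp (hux x).aestronglyMeasurable
      _ = ∫⁻ σ, ∫⁻ x, ‖u x σ‖ₑ ^ p.toReal ∂μ ∂ν := by
          refine lintegral_lintegral_swap ?_
          exact (hu.enorm.measurable.pow_const _).aemeasurable
      _ ≤ ∫⁻ _, M ^ p.toReal ∂ν := by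
          refine lintegral_mono_ae ?_
          filter_upwards [hM] with σ hσ
          rw [← key]
          gcongr
      _ = M ^ p.toReal := by simp

end AlgApprox

namespace AlgApprox

/-! ### Bounds for weighted differences of polynomials -/

/-- The `k`th difference without the restriction to `[-1, 1]`. -/
noncomputable def freeDiff (k : ℕ) (h : ℝ) (F : ℝ → ℝ) (x : ℝ) : ℝ :=
  ∑ i ∈ Finset.range (k + 1),
    (k.choose i : ℝ) * (-1) ^ (k - i) * F (x + ((i : ℝ) - (k : ℝ) / 2) * h * phi x)

/-- The default value 0 of `symmDiffK` becomes a restriction of the measure to `diffDom`; the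
endpoints ±1 are a null set. -/
lemma eLpNorm_wt_symmDiffK (k r : ℕ) (h : ℝ) (p : ℝ≥0∞) (F : ℝ → ℝ) :
    eLpNorm (fun x => wt (k * h) x ^ r * symmDiffK k (h * phi x) F x) p μI =
      eLpNorm (fun x => wt (k * h) x ^ r * freeDiff k h F x) p
        (volume.restrict (diffDom (k * h / 2))) := by
  have hsub : diffDom (k * h / 2) ⊆ Ioo (-1) 1 := fun _ hx => hx.1
  rw [← inter_eq_left.2 hsub, ← Measure.restrict_restrict (measurableSet_diffDom _), ← μI_eq_Ioo,
    ← eLpNorm_indicator_eq_eLpNorm_restrict (measurableSet_diffDom _)]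
  refine eLpNorm_congr_ae ?_
  rw [μI_eq_Ioo]
  filter_upwards [ae_restrict_mem measurableSet_Ioo] with x hx
  have e : (k : ℝ) * (h * phi x) / 2 = k * h / 2 * phi x := by ring
  by_cases hd : x ∈ diffDom (k * h / 2)
  · rw [indicator_of_mem hd, symmDiffK, e, if_pos hd.2, freeDiff]
    simp only [mul_assoc]
  · rw [indicator_of_notMem hd, symmDiffK, e, if_neg (fun h' => hd ⟨hx, h'⟩), mul_zero]

lemma abs_node_le {k i : ℕ} (hi : i ∈ Finset.range (k + 1)) {h : ℝ} (hh : 0 ≤ h) :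
    |((i : ℝ) - (k : ℝ) / 2) * h| ≤ k * h / 2 := by
  have hi' : (i : ℝ) ≤ k := by exact_mod_cast Nat.lt_succ_iff.1 (Finset.mem_range.1 hi)
  have hi0 : (0 : ℝ) ≤ i := Nat.cast_nonneg i
  rw [abs_mul, abs_of_nonneg hh, mul_div_right_comm]
  gcongr
  rw [abs_le]; constructor <;> linarith

lemma sum_enorm_choose (k : ℕ) :
    ∑ i ∈ Finset.range (k + 1), ‖(k.choose i : ℝ) * (-1) ^ (k - i)‖ₑ = 2 ^ k := by
  have : ∀ i ∈ Finset.range (k + 1), ‖(k.choose i : ℝ) * (-1) ^ (k - i)‖ₑ =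
      ((k.choose i : ℕ) : ℝ≥0∞) := by
    intro i _
    rw [← ofReal_norm, norm_mul, norm_pow, norm_neg, norm_one, one_pow, mul_one,
      Real.norm_natCast, ENNReal.ofReal_natCast]
  rw [Finset.sum_congr rfl this, ← Nat.cast_sum, Nat.sum_range_choose]
  norm_cast

lemma eLpNorm_sum_choose_le {k : ℕ} {p : ℝ≥0∞} (hp : 1 ≤ p) {μ : Measure ℝ} {g : ℕ → ℝ → ℝ}
    (hg : ∀ i, Continuous (g i)) {M : ℝ≥0∞}
    (hM : ∀ i ∈ Finset.range (k + 1), eLpNorm (g i) p μ ≤ M) :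
    eLpNorm (fun x => ∑ i ∈ Finset.range (k + 1), (k.choose i : ℝ) * (-1) ^ (k - i) * g i x) p μ ≤
      2 ^ k * M := by
  have hfun : (fun x => ∑ i ∈ Finset.range (k + 1), (k.choose i : ℝ) * (-1) ^ (k - i) * g i x) =
      ∑ i ∈ Finset.range (k + 1), ((k.choose i : ℝ) * (-1) ^ (k - i)) • g i := by
    ext x; simp
  rw [hfun]
  refine (eLpNorm_sum_le (fun i _ => ((hg i).const_smul _).aestronglyMeasurable) hp).trans ?_
  rw [← sum_enorm_choose, Finset.sum_mul]
  refine Finset.sum_le_sum fun i hi => ?_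
  rw [eLpNorm_const_smul]
  exact mul_le_mul_right (hM i hi) _

/-- At each node the weight is dominated by φ^r there, the change of variables costs 2, and the
binomial coefficients add up to 2^k. -/
theorem eLpNorm_symmDiffK_le (k r : ℕ) {h : ℝ} (hh : 0 ≤ h) {p : ℝ≥0∞} (hp : 1 ≤ p)
    {F : ℝ → ℝ} (hF : Continuous F) :
    eLpNorm (fun x => wt (k * h) x ^ r * symmDiffK k (h * phi x) F x) p μI ≤
      2 ^ k * (2 * eLpNorm (fun x => phi x ^ r * F x) p μI) := by
  have hcw := continuous_wt (k * h)
  have hcp := continuous_phi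
  rw [eLpNorm_wt_symmDiffK]
  have : (fun x => wt (k * h) x ^ r * freeDiff k h F x) = fun x =>
      ∑ i ∈ Finset.range (k + 1), (k.choose i : ℝ) * (-1) ^ (k - i) *
        (wt (k * h) x ^ r * F (x + ((i : ℝ) - (k : ℝ) / 2) * h * phi x)) := by
    ext x
    rw [freeDiff, Finset.mul_sum]
    exact Finset.sum_congr rfl fun i _ => by ring
  rw [this]
  refine eLpNorm_sum_choose_le hp (fun i => by fun_prop) fun i hi => ?_
  have hc := abs_node_le hi hh
  refine le_trans ?_ (eLpNorm_comp_shift_le hc hp (G := fun x => phi x ^ r * F x) (by fun_prop))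
  refine eLpNorm_mono_ae ?_
  filter_upwards [ae_restrict_mem (measurableSet_diffDom _)] with x hx
  simp only [norm_mul, norm_pow, Real.norm_of_nonneg (wt_nonneg _ _),
    Real.norm_of_nonneg (phi_nonneg _)]
  gcongr
  · exact wt_nonneg _ _
  · exact wt_le_phi_shift hc hx

/-- The Taylor polynomial of degree `< k` at `s`, evaluated at `y`. -/
noncomputable def taylorVal (F : Polynomial ℝ) (k : ℕ) (y s : ℝ) : ℝ :=
  ∑ j ∈ Finset.range k, (Polynomial.derivative^[j] F).eval s * (y - s) ^ j / (j.factorial : ℝ)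

lemma hasDerivAt_taylorVal (F : Polynomial ℝ) (m : ℕ) (y s : ℝ) :
    HasDerivAt (taylorVal F (m + 1) y)
      ((Polynomial.derivative^[m + 1] F).eval s * (y - s) ^ m / (m.factorial : ℝ)) s := by
  induction m with
  | zero =>
    have := F.hasDerivAt s
    unfold taylorVal
    simpa using this
  | succ m ih =>
    have h1 := (Polynomial.derivative^[m + 1] F).hasDerivAt s
    rw [← Function.iterate_succ_apply' Polynomial.derivative] at h1
    have h2 : HasDerivAt (fun s => (y - s) ^ (m + 1)) (-((m + 1 : ℕ) * (y - s) ^ m)) s := by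
      have := ((hasDerivAt_id s).const_sub y).fun_pow (m + 1)
      simpa using this
    have h3 := ih.add ((h1.fun_mul h2).div_const ((m + 1).factorial : ℝ))
    have e : taylorVal F (m + 1 + 1) y = taylorVal F (m + 1) y + fun s =>
        (Polynomial.derivative^[m + 1] F).eval s * (y - s) ^ (m + 1) / ((m + 1).factorial : ℝ) := by
      ext s
      simp only [taylorVal, Pi.add_apply]
      rw [Finset.sum_range_succ]
    rw [e]
    refine h3.congr_deriv ?_
    rw [Nat.factorial_succ]
    push_cast
    have : (m.factorial : ℝ) ≠ 0 := by positivity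
    have : (m + 1 : ℝ) ≠ 0 := by positivity
    field_simp
    ring

lemma taylorVal_self (F : Polynomial ℝ) (m : ℕ) (y : ℝ) : taylorVal F (m + 1) y y = F.eval y := by
  rw [taylorVal, Finset.sum_range_succ']
  simp

/-- Taylor's formula with the integral remainder in quadratic parametrisation. -/
theorem eval_sub_taylorVal (F : Polynomial ℝ) (m : ℕ) (x y : ℝ) :
    F.eval y - taylorVal F (m + 1) y x = (y - x) ^ (m + 1) / (m.factorial : ℝ) *
      ∫ σ in (0 : ℝ)..1, 2 * σ ^ (2 * m + 1) *
        (Polynomial.derivative^[m + 1] F).eval (y + (x - y) * σ ^ 2) := by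
  have hder : ∀ σ : ℝ, HasDerivAt (fun σ => taylorVal F (m + 1) y (y + (x - y) * σ ^ 2))
      (-((y - x) ^ (m + 1) / (m.factorial : ℝ) * (2 * σ ^ (2 * m + 1) *
        (Polynomial.derivative^[m + 1] F).eval (y + (x - y) * σ ^ 2)))) σ := by
    intro σ
    have h1 : HasDerivAt (fun σ : ℝ => y + (x - y) * σ ^ 2) ((x - y) * (2 * σ)) σ := by
      simpa using ((hasDerivAt_pow 2 σ).const_mul (x - y)).const_add y
    refine ((hasDerivAt_taylorVal F m y _).comp σ h1).congr_deriv ?_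
    have e : y - (y + (x - y) * σ ^ 2) = (y - x) * σ ^ 2 := by ring
    rw [e, mul_pow]
    ring
  have hint := intervalIntegral.integral_eq_sub_of_hasDerivAt (a := 0) (b := 1)
    (fun σ _ => hder σ) (by
      refine Continuous.intervalIntegrable ?_ _ _
      have := (Polynomial.derivative^[m + 1] F).continuous
      fun_prop)
  rw [intervalIntegral.integral_neg, intervalIntegral.integral_const_mul] at hint
  have e1 : y + (x - y) * 1 ^ 2 = x := by ring
  have e0 : y + (x - y) * 0 ^ 2 = y := by ring
  rw [e1, e0, taylorVal_self] at hint
  linarith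

lemma sum_choose_mul_eval_eq_zero {k : ℕ} {P : Polynomial ℝ} (hP : P.natDegree < k) :
    ∑ i ∈ Finset.range (k + 1), (k.choose i : ℝ) * (-1) ^ (k - i) * P.eval (i : ℝ) = 0 := by
  have h := congr_fun (Polynomial.fwdDiff_iter_eq_zero_of_degree_lt hP) 0
  rw [fwdDiff_iter_eq_sum_shift] at h
  simp only [zero_add, Pi.zero_apply, nsmul_eq_mul, mul_one, zsmul_eq_mul] at h
  rw [← h]
  refine Finset.sum_congr rfl fun i _ => ?_
  push_cast
  ring

/-- As a function of the node index i, the Taylor polynomial at x is a polynomial of degree below k,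
so the kth difference annihilates it. -/
lemma freeDiff_eq_remainder (k : ℕ) (h : ℝ) (F : Polynomial ℝ) (x : ℝ) :
    freeDiff k h (fun x => F.eval x) x = ∑ i ∈ Finset.range (k + 1),
      (k.choose i : ℝ) * (-1) ^ (k - i) *
        (F.eval (x + ((i : ℝ) - (k : ℝ) / 2) * h * phi x) -
          taylorVal F k (x + ((i : ℝ) - (k : ℝ) / 2) * h * phi x) x) := by
  simp only [mul_sub, Finset.sum_sub_distrib]
  rw [freeDiff, eq_comm, sub_eq_self]
  simp only [taylorVal, Finset.mul_sum]
  rw [Finset.sum_comm]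
  refine Finset.sum_eq_zero fun j hj => ?_
  have hP : ((Polynomial.C (h * phi x) * Polynomial.X +
      Polynomial.C (-((k : ℝ) / 2 * h * phi x))) ^ j).natDegree < k := by
    refine lt_of_le_of_lt (Polynomial.natDegree_pow_le_of_le j Polynomial.natDegree_linear_le) ?_
    simpa using hj
  have h0 := sum_choose_mul_eval_eq_zero hP
  calc _ = (Polynomial.derivative^[j] F).eval x / (j.factorial : ℝ) *
        ∑ i ∈ Finset.range (k + 1), (k.choose i : ℝ) * (-1) ^ (k - i) *
          ((Polynomial.C (h * phi x) * Polynomial.X +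
            Polynomial.C (-((k : ℝ) / 2 * h * phi x))) ^ j).eval (i : ℝ) := by
        rw [Finset.mul_sum]
        refine Finset.sum_congr rfl fun i _ => ?_
        simp only [Polynomial.eval_pow, Polynomial.eval_add, Polynomial.eval_mul,
          Polynomial.eval_C, Polynomial.eval_X]
        have : x + ((i : ℝ) - (k : ℝ) / 2) * h * phi x - x =
          h * phi x * i + -((k : ℝ) / 2 * h * phi x) := by ring
        rw [this]; ring
    _ = 0 := by rw [h0, mul_zero]

/-- The point is to bring the factors `wt δ x ^ r` and φ(x)^(m+1), taken at x, inside the integral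
as a power of φ at the point where the derivative is evaluated. Each such point is again an
admissible shift of x. -/
lemma abs_remainder_le (F : Polynomial ℝ) (m r : ℕ) {δ c x : ℝ} (hc : |c| ≤ δ / 2)
    (hx : x ∈ diffDom (δ / 2)) :
    |wt δ x ^ r * (F.eval (x + c * phi x) - taylorVal F (m + 1) (x + c * phi x) x)| ≤
      2 * (δ / 2) ^ (m + 1) * ∫ σ in (0 : ℝ)..1, phi (x + ((1 - σ ^ 2) * c) * phi x) ^ (m + 1 + r) *
        |(Polynomial.derivative^[m + 1] F).eval (x + ((1 - σ ^ 2) * c) * phi x)| := by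
  have hcp := continuous_phi
  have hFc := (Polynomial.derivative^[m + 1] F).continuous
  have hp := phi_nonneg x
  have hd : 0 ≤ δ / 2 := (abs_nonneg c).trans hc
  have hw := wt_nonneg δ x
  rw [eval_sub_taylorVal, add_sub_cancel_left, abs_mul, abs_mul, abs_div, abs_pow, abs_pow, abs_mul,
    abs_of_nonneg hp, abs_of_nonneg hw, Nat.abs_cast]
  have hfac : (1 : ℝ) ≤ m.factorial := by exact_mod_cast Nat.one_le_iff_ne_zero.2 m.factorial_ne_zero
  have h1 : (|c| * phi x) ^ (m + 1) / (m.factorial : ℝ) ≤ (δ / 2) ^ (m + 1) * phi x ^ (m + 1) := by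
    rw [← mul_pow]
    exact (div_le_self (by positivity) hfac).trans (by gcongr)
  have h2 : |∫ σ in (0 : ℝ)..1, 2 * σ ^ (2 * m + 1) * (Polynomial.derivative^[m + 1] F).eval
      (x + c * phi x + (x - (x + c * phi x)) * σ ^ 2)| ≤
      ∫ σ in (0 : ℝ)..1, 2 * σ ^ (2 * m + 1) * |(Polynomial.derivative^[m + 1] F).eval
      (x + ((1 - σ ^ 2) * c) * phi x)| := by
    refine (intervalIntegral.abs_integral_le_integral_abs zero_le_one).trans ?_
    refine intervalIntegral.integral_mono_on zero_le_one
      (Continuous.intervalIntegrable (by fun_prop) _ _)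
      (Continuous.intervalIntegrable (by fun_prop) _ _) fun σ hσ => ?_
    have hσ0 := hσ.1
    rw [abs_mul, abs_of_nonneg (by positivity)]
    have : x + c * phi x + (x - (x + c * phi x)) * σ ^ 2 = x + ((1 - σ ^ 2) * c) * phi x := by ring
    rw [this]
  calc _ ≤ wt δ x ^ r * ((δ / 2) ^ (m + 1) * phi x ^ (m + 1) *
        ∫ σ in (0 : ℝ)..1, 2 * σ ^ (2 * m + 1) * |(Polynomial.derivative^[m + 1] F).eval
      (x + ((1 - σ ^ 2) * c) * phi x)|) := by gcongr
    _ = 2 * (δ / 2) ^ (m + 1) * ∫ σ in (0 : ℝ)..1, wt δ x ^ r * phi x ^ (m + 1) * (σ ^ (2 * m + 1) *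
        |(Polynomial.derivative^[m + 1] F).eval (x + ((1 - σ ^ 2) * c) * phi x)|) := by
        rw [intervalIntegral.integral_const_mul]
        simp only [mul_assoc (2 : ℝ)]
        rw [intervalIntegral.integral_const_mul]
        ring
    _ ≤ _ := by
        refine mul_le_mul_of_nonneg_left ?_ (by positivity)
        refine intervalIntegral.integral_mono_on zero_le_one
          (Continuous.intervalIntegrable (by fun_prop) _ _)
          (Continuous.intervalIntegrable (by fun_prop) _ _) fun σ hσ => ?_
        have hσ0 := hσ.1
        have hσ1 : σ ^ 2 ≤ 1 := pow_le_one₀ hσ.1 hσ.2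
        have hc' : |(1 - σ ^ 2) * c| ≤ δ / 2 := by
          rw [abs_mul, abs_of_nonneg (by linarith)]
          nlinarith [abs_nonneg c, sq_nonneg σ]
        have a1 := wt_le_phi_shift hc' hx
        have a2 := mul_phi_le_phi (diffDom_subset _ hx) (shift_mem_Icc hc hx) hσ
        have : x + c * phi x + (x - (x + c * phi x)) * σ ^ 2 =
          x + ((1 - σ ^ 2) * c) * phi x := by ring
        rw [this] at a2
        set v := phi (x + ((1 - σ ^ 2) * c) * phi x)
        have hv : 0 ≤ v := phi_nonneg _
        -- Of σ^(2m+1), the part σ^(m+1) compensates for φ being possibly smaller at the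
        -- intermediate point than at x, and σ^m is discarded. The quadratic parametrisation
        -- provides this power.
        calc _ = σ ^ m * (wt δ x ^ r * (σ * phi x) ^ (m + 1)) *
              |(Polynomial.derivative^[m + 1] F).eval (x + ((1 - σ ^ 2) * c) * phi x)| := by ring
          _ ≤ 1 * (v ^ r * v ^ (m + 1)) *
              |(Polynomial.derivative^[m + 1] F).eval (x + ((1 - σ ^ 2) * c) * phi x)| := by
              gcongr
              exact pow_le_one₀ hσ.1 hσ.2
          _ = _ := by ring

theorem eLpNorm_symmDiffK_le_derivative (m r : ℕ) {h : ℝ} (hh : 0 ≤ h) {p : ℝ≥0∞} (hp : 1 ≤ p)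
    (F : Polynomial ℝ) :
    eLpNorm (fun x => wt ((m + 1 : ℕ) * h) x ^ r *
        symmDiffK (m + 1) (h * phi x) (fun x => F.eval x) x) p μI ≤
      2 ^ (m + 1) * (ENNReal.ofReal (2 * ((m + 1 : ℕ) * h / 2) ^ (m + 1)) * (2 *
        eLpNorm (fun x => phi x ^ (m + 1 + r) *
          (Polynomial.derivative^[m + 1] F).eval x) p μI)) := by
  set δ := ((m + 1 : ℕ) : ℝ) * h with hδ
  have hδ0 : 0 ≤ δ := by positivity
  have hcw := continuous_wt δ
  have hcp := continuous_phi
  have hFc := (Polynomial.derivative^[m + 1] F).continuous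
  have hFc0 := F.continuous
  rw [eLpNorm_wt_symmDiffK]
  have : (fun x => wt δ x ^ r * freeDiff (m + 1) h (fun x => F.eval x) x) = fun x =>
      ∑ i ∈ Finset.range (m + 1 + 1), ((m + 1).choose i : ℝ) * (-1) ^ (m + 1 - i) *
        (wt δ x ^ r * (F.eval (x + ((i : ℝ) - ((m + 1 : ℕ) : ℝ) / 2) * h * phi x) -
          taylorVal F (m + 1) (x + ((i : ℝ) - ((m + 1 : ℕ) : ℝ) / 2) * h * phi x) x)) := by
    ext x
    rw [freeDiff_eq_remainder, Finset.mul_sum]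
    exact Finset.sum_congr rfl fun i _ => by ring
  rw [← hδ, this]
  refine eLpNorm_sum_choose_le hp (fun i => ?_) fun i hi => ?_
  · have : ∀ j, Continuous (fun x => (Polynomial.derivative^[j] F).eval x) :=
      fun j => (Polynomial.derivative^[j] F).continuous
    unfold taylorVal
    fun_prop
  set c := ((i : ℝ) - ((m + 1 : ℕ) : ℝ) / 2) * h
  have hc : |c| ≤ δ / 2 := abs_node_le hi hh
  set G : ℝ → ℝ := fun x => phi x ^ (m + 1 + r) * |(Polynomial.derivative^[m + 1] F).eval x| with hG
  have hGc : Continuous G := by fun_prop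
  set U : ℝ → ℝ := fun x => ∫ σ in Ioc (0 : ℝ) 1, G (x + ((1 - σ ^ 2) * c) * phi x) with hU
  have h1 : eLpNorm (fun x => wt δ x ^ r * (F.eval (x + c * phi x) -
      taylorVal F (m + 1) (x + c * phi x) x)) p (volume.restrict (diffDom (δ / 2))) ≤
      eLpNorm ((2 * (δ / 2) ^ (m + 1)) • U) p (volume.restrict (diffDom (δ / 2))) := by
    refine eLpNorm_mono_ae ?_
    filter_upwards [ae_restrict_mem (measurableSet_diffDom _)] with x hx
    refine (abs_remainder_le F m r hc hx).trans ?_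
    rw [intervalIntegral.integral_of_le zero_le_one]
    exact Real.le_norm_self _
  refine h1.trans ?_
  rw [eLpNorm_const_smul, ← ofReal_norm, Real.norm_of_nonneg (by positivity)]
  refine mul_le_mul_right ?_ _
  have : IsProbabilityMeasure (volume.restrict (Ioc (0 : ℝ) 1)) := ⟨by simp⟩
  have hGn : eLpNorm G p μI = eLpNorm (fun x => phi x ^ (m + 1 + r) *
      (Polynomial.derivative^[m + 1] F).eval x) p μI :=
    eLpNorm_congr_norm_ae (Filter.Eventually.of_forall fun x => by simp [hG])
  rw [← hGn]
  refine eLpNorm_integral_le hp (u := fun x σ => G (x + ((1 - σ ^ 2) * c) * phi x))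
    (by fun_prop) ?_
  filter_upwards [ae_restrict_mem measurableSet_Ioc] with σ hσ
  refine eLpNorm_comp_shift_le ?_ hp hGc
  have hσ1 : σ ^ 2 ≤ 1 := pow_le_one₀ hσ.1.le hσ.2
  rw [abs_mul, abs_of_nonneg (by linarith)]
  nlinarith [abs_nonneg c, sq_nonneg σ]

end AlgApprox

namespace AlgApprox

open Filter Topology

/-! ### Limits of sequences of polynomials with summable weighted derivatives -/

/-- The `s`th derivative of the `j`th difference of the sequence `P`. -/
noncomputable def dser (P : ℕ → Polynomial ℝ) (s j : ℕ) (x : ℝ) : ℝ :=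
  (Polynomial.derivative^[s] (P (j + 1) - P j)).eval x

/-- The pointwise limit of the `s`th derivatives of the sequence `P`. -/
noncomputable def limFun (P : ℕ → Polynomial ℝ) (s : ℕ) (x : ℝ) : ℝ :=
  (Polynomial.derivative^[s] (P 0)).eval x + ∑' j, dser P s j x

lemma continuous_dser (P : ℕ → Polynomial ℝ) (s j : ℕ) : Continuous (dser P s j) :=
  Polynomial.continuous _

lemma hasDerivAt_dser (P : ℕ → Polynomial ℝ) (s j : ℕ) (x : ℝ) :
    HasDerivAt (dser P s j) (dser P (s + 1) j x) x := by
  have h := (Polynomial.derivative^[s] (P (j + 1) - P j)).hasDerivAt x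
  rw [← Function.iterate_succ_apply' Polynomial.derivative] at h
  exact h

lemma tendsto_limFun {P : ℕ → Polynomial ℝ} {s : ℕ} {x : ℝ}
    (h : Summable fun j => dser P s j x) :
    Tendsto (fun j => (Polynomial.derivative^[s] (P j)).eval x) atTop (𝓝 (limFun P s x)) := by
  have e : ∀ n, (Polynomial.derivative^[s] (P n)).eval x =
      (Polynomial.derivative^[s] (P 0)).eval x + ∑ j ∈ Finset.range n, dser P s j x := by
    intro n
    have : ∀ j, dser P s j x = (Polynomial.derivative^[s] (P (j + 1))).eval x -
        (Polynomial.derivative^[s] (P j)).eval x := by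
      intro j
      rw [dser, Polynomial.iterate_derivative_sub, Polynomial.eval_sub]
    simp only [this]
    rw [Finset.sum_range_sub (fun j => (Polynomial.derivative^[s] (P j)).eval x)]
    ring
  rw [show (fun j => (Polynomial.derivative^[s] (P j)).eval x) = _ from funext e]
  exact h.hasSum.tendsto_sum_nat.const_add _

/-- Weighted summability of the derivatives of order `s` in `L_p`. -/
def WSummable (P : ℕ → Polynomial ℝ) (p : ℝ≥0∞) (s : ℕ) : Prop :=
  ∑' j, eLpNorm (fun x => phi x ^ s * dser P s j x) p μI ≠ ⊤

lemma continuous_weighted (s : ℕ) {F : ℝ → ℝ} (hF : Continuous F) :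
    Continuous (fun x => phi x ^ s * F x) := by
  have := continuous_phi
  fun_prop

lemma WSummable.ae_summable {P : ℕ → Polynomial ℝ} {p : ℝ≥0∞} {s : ℕ} (hp : 1 ≤ p)
    (h : WSummable P p s) : ∀ᵐ x ∂μI, Summable fun j => dser P s j x := by
  have h1 := summable_norm_of_tsum_eLpNorm_ne_top hp
    (fun j => (continuous_weighted s (continuous_dser P s j)).aestronglyMeasurable) h
  have h2 : ∀ᵐ x ∂μI, x ∈ Ioo (-1 : ℝ) 1 := by
    rw [μI_eq_Ioo]; exact ae_restrict_mem measurableSet_Ioo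
  filter_upwards [h1, h2] with x hx hx1
  have h3 := (hx.of_norm).mul_left (phi x ^ s)⁻¹
  have hpos := pow_pos (phi_pos hx1) s
  refine h3.congr fun j => ?_
  rw [← mul_assoc, inv_mul_cancel₀ hpos.ne', one_mul]

lemma phi_le_phi_of_abs_le {x a : ℝ} (h : |x| ≤ a) : phi a ≤ phi x := by
  refine Real.sqrt_le_sqrt ?_
  have : x ^ 2 ≤ a ^ 2 := sq_le_sq' (abs_le.1 h).1 (abs_le.1 h).2
  linarith

/-- Unweighted summability on compact subintervals. -/
lemma WSummable.summable_integral {P : ℕ → Polynomial ℝ} {p : ℝ≥0∞} {s : ℕ} (hp : 1 ≤ p)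
    (h : WSummable P p s) {a : ℝ} (ha0 : 0 < a) (ha : a < 1) :
    Summable fun j => ∫ x in (-a)..a, |dser P s j x| := by
  set ν := volume.restrict (Ioc (-a) a)
  have hν : ν ≤ μI := Measure.restrict_mono
    (Ioc_subset_Icc_self.trans (Icc_subset_Icc (by linarith) ha.le)) le_rfl
  have hpa : 0 < phi a := phi_pos ⟨by linarith, ha⟩
  set K : ℝ≥0∞ := ENNReal.ofReal ((phi a ^ s)⁻¹) with hK
  set K' : ℝ≥0∞ := ν univ ^ (1 / (1 : ℝ≥0∞).toReal - 1 / p.toReal) with hK'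
  have hK't : K' ≠ ⊤ := by
    refine ENNReal.rpow_ne_top_of_nonneg ?_ (measure_ne_top _ _)
    rw [ENNReal.toReal_one, one_div_one, sub_nonneg, one_div]
    rcases eq_or_ne p ⊤ with rfl | hpt
    · simp
    · refine inv_le_one_of_one_le₀ ?_
      rwa [← ENNReal.ofReal_le_iff_le_toReal hpt, ENNReal.ofReal_one]
  have hbound : ∀ j, ENNReal.ofReal (∫ x in (-a)..a, |dser P s j x|) ≤
      K * K' * eLpNorm (fun x => phi x ^ s * dser P s j x) p μI := by
    intro j
    have hc := continuous_dser P s j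
    have hcp := continuous_phi
    have h1 : ENNReal.ofReal (∫ x in (-a)..a, |dser P s j x|) = eLpNorm (dser P s j) 1 ν := by
      rw [intervalIntegral.integral_of_le (by linarith), eLpNorm_one_eq_lintegral_enorm]
      exact ofReal_integral_norm_eq_lintegral_enorm (hc.integrableOn_Ioc)
    -- On [-a, a] the weight is at least φ(a)^s, so it can be removed; Hölder then passes from L_p
    -- to L_1.
    have h2 : eLpNorm (dser P s j) p ν ≤
        eLpNorm ((phi a ^ s)⁻¹ • fun x => phi x ^ s * dser P s j x) p ν := by
      refine eLpNorm_mono_ae ?_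
      filter_upwards [ae_restrict_mem measurableSet_Ioc] with x hx
      have hle : phi a ≤ phi x := phi_le_phi_of_abs_le (abs_le.2 ⟨hx.1.le, hx.2⟩)
      rw [Pi.smul_apply, smul_eq_mul, norm_mul, norm_mul, ← mul_assoc, ← norm_mul]
      refine le_mul_of_one_le_left (norm_nonneg _) ?_
      rw [Real.norm_of_nonneg (by have := phi_nonneg x; positivity), inv_mul_eq_div,
        one_le_div (by positivity)]
      gcongr
    calc _ = eLpNorm (dser P s j) 1 ν := h1
      _ ≤ eLpNorm (dser P s j) p ν * K' :=
          eLpNorm_le_eLpNorm_mul_rpow_measure_univ hp hc.aestronglyMeasurable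
      _ ≤ (K * eLpNorm (fun x => phi x ^ s * dser P s j x) p μI) * K' := by
          gcongr
          refine h2.trans ?_
          rw [eLpNorm_const_smul, ← ofReal_norm, Real.norm_of_nonneg (by positivity)]
          exact mul_le_mul_right (eLpNorm_mono_measure _ hν) _
      _ = _ := by ring
  have hfin : ∑' j, ENNReal.ofReal (∫ x in (-a)..a, |dser P s j x|) ≠ ⊤ := by
    refine ne_top_of_le_ne_top ?_ (ENNReal.tsum_le_tsum hbound)
    rw [ENNReal.tsum_mul_left]
    exact ENNReal.mul_ne_top (ENNReal.mul_ne_top ENNReal.ofReal_ne_top hK't) h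
  have := ENNReal.summable_toReal hfin
  refine this.congr fun j => ?_
  rw [ENNReal.toReal_ofReal]
  exact intervalIntegral.integral_nonneg (by linarith) fun x _ => abs_nonneg _

/-- One-dimensional Sobolev inequality: average |F(x)| ≤ |F(y)| + ∫|F'| over y. It turns L_1
summability of two consecutive derivatives into locally uniform convergence. -/
lemma abs_le_integral_add {F F' : ℝ → ℝ} (hF : ∀ x, HasDerivAt F (F' x) x) (hF' : Continuous F')
    {a : ℝ} (ha : 0 < a) {x : ℝ} (hx : x ∈ Icc (-a) a) :
    |F x| ≤ (2 * a)⁻¹ * (∫ y in (-a)..a, |F y|) + ∫ y in (-a)..a, |F' y| := by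
  have hFc : Continuous F := continuous_iff_continuousAt.2 fun x => (hF x).continuousAt
  have h1 : ∀ y ∈ Icc (-a) a, |F x| ≤ |F y| + ∫ y in (-a)..a, |F' y| := by
    intro y hy
    have h2 : ∫ u in y..x, F' u = F x - F y :=
      intervalIntegral.integral_eq_sub_of_hasDerivAt (fun u _ => hF u)
        (hF'.intervalIntegrable _ _)
    have h3 : |F x - F y| ≤ ∫ y in (-a)..a, |F' y| := by
      rw [← h2]
      have h4 := intervalIntegral.norm_integral_le_integral_norm_uIoc (f := F') (a := y) (b := x)
        (μ := volume)
      rw [intervalIntegral.integral_of_le (show -a ≤ a by linarith)]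
      refine h4.trans ?_
      refine setIntegral_mono_set (hF'.abs.integrableOn_Ioc) (ae_of_all _ fun _ => abs_nonneg _) ?_
      refine LE.le.eventuallyLE ?_
      intro u hu
      rcases le_total y x with hyx | hyx
      · rw [uIoc_of_le hyx] at hu
        exact ⟨hy.1.trans_lt hu.1, hu.2.trans hx.2⟩
      · rw [uIoc_of_ge hyx] at hu
        exact ⟨hx.1.trans_lt hu.1, hu.2.trans hy.2⟩
    have h5 : |F x| ≤ |F y| + |F x - F y| := by
      have := abs_add_le (F y) (F x - F y)
      rwa [add_sub_cancel] at this
    linarith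
  have h6 := intervalIntegral.integral_mono_on (μ := volume) (a := -a) (b := a) (by linarith)
    (f := fun _ => |F x|) (g := fun y => |F y| + ∫ y in (-a)..a, |F' y|)
    (continuous_const.intervalIntegrable _ _)
    ((hFc.abs.add continuous_const).intervalIntegrable _ _) h1
  rw [intervalIntegral.integral_add (hFc.abs.intervalIntegrable _ _)
    (continuous_const.intervalIntegrable _ _), intervalIntegral.integral_const,
    intervalIntegral.integral_const, smul_eq_mul, smul_eq_mul] at h6
  rw [← mul_le_mul_iff_right₀ (show (0 : ℝ) < 2 * a by linarith), mul_add, ← mul_assoc,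
    mul_inv_cancel₀ (by linarith), one_mul]
  linarith

/-- A summable uniform bound for `dser P s j` on `[-a, a]`. -/
noncomputable def dserBound (P : ℕ → Polynomial ℝ) (s : ℕ) (a : ℝ) (j : ℕ) : ℝ :=
  (2 * a)⁻¹ * (∫ y in (-a)..a, |dser P s j y|) + ∫ y in (-a)..a, |dser P (s + 1) j y|

lemma summable_dserBound {P : ℕ → Polynomial ℝ} {p : ℝ≥0∞} {s : ℕ} (hp : 1 ≤ p)
    (h : WSummable P p s) (h' : WSummable P p (s + 1)) {a : ℝ} (ha0 : 0 < a) (ha : a < 1) :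
    Summable (dserBound P s a) :=
  ((h.summable_integral hp ha0 ha).mul_left _).add (h'.summable_integral hp ha0 ha)

lemma norm_dser_le (P : ℕ → Polynomial ℝ) (s j : ℕ) {a : ℝ} (ha : 0 < a) {x : ℝ}
    (hx : x ∈ Icc (-a) a) : ‖dser P s j x‖ ≤ dserBound P s a j :=
  abs_le_integral_add (hasDerivAt_dser P s j) (continuous_dser P (s + 1) j) ha hx

lemma exists_mem_Ioo_neg {x : ℝ} (hx : x ∈ Ioo (-1 : ℝ) 1) :
    ∃ a : ℝ, 0 < a ∧ a < 1 ∧ x ∈ Ioo (-a) a := by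
  have h := abs_lt.2 hx
  refine ⟨(1 + |x|) / 2, by positivity, by linarith, ?_⟩
  exact abs_lt.1 (by linarith)

lemma summable_dser {P : ℕ → Polynomial ℝ} {p : ℝ≥0∞} {s : ℕ} (hp : 1 ≤ p)
    (h : WSummable P p s) (h' : WSummable P p (s + 1)) {x : ℝ} (hx : x ∈ Ioo (-1 : ℝ) 1) :
    Summable fun j => dser P s j x := by
  obtain ⟨a, ha0, ha, hxa⟩ := exists_mem_Ioo_neg hx
  exact (summable_dserBound hp h h' ha0 ha).of_norm_bounded
    fun j => norm_dser_le P s j ha0 (Ioo_subset_Icc_self hxa)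

/-- Termwise differentiation needs locally uniform convergence of the derivatives of order s + 1,
which uses summability up to order s + 2. The last derivative therefore needs a separate argument.
-/
lemma hasDerivAt_limFun {P : ℕ → Polynomial ℝ} {p : ℝ≥0∞} {s : ℕ} (hp : 1 ≤ p)
    (h : WSummable P p s) (h' : WSummable P p (s + 1)) (h'' : WSummable P p (s + 2))
    {x : ℝ} (hx : x ∈ Ioo (-1 : ℝ) 1) :
    HasDerivAt (limFun P s) (limFun P (s + 1) x) x := by
  obtain ⟨a, ha0, ha, hxa⟩ := exists_mem_Ioo_neg hx
  have h1 := hasDerivAt_tsum_of_isPreconnected (summable_dserBound hp h' h'' ha0 ha) isOpen_Ioo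
    isPreconnected_Ioo (fun j y _ => hasDerivAt_dser P s j y)
    (fun j y hy => norm_dser_le P (s + 1) j ha0 (Ioo_subset_Icc_self hy)) hxa
    (summable_dser hp h h' hx) hxa
  have h2 := (Polynomial.derivative^[s] (P 0)).hasDerivAt x
  rw [← Function.iterate_succ_apply' Polynomial.derivative] at h2
  exact h2.add h1

/-- For the top derivative only L_1 convergence is available. Termwise integration still makes the
previous one its primitive, hence locally absolutely continuous. -/
lemma integrable_limFun_and_eq {P : ℕ → Polynomial ℝ} {p : ℝ≥0∞} {s : ℕ} (hp : 1 ≤ p)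
    (h : WSummable P p s) (h' : WSummable P p (s + 1)) {a : ℝ} (ha0 : 0 < a) (ha : a < 1) :
    IntervalIntegrable (limFun P (s + 1)) volume (-a) a ∧
      ∀ x ∈ Icc (-a) a, limFun P s x = limFun P s 0 + ∫ y in (0 : ℝ)..x, limFun P (s + 1) y := by
  have hsum := h'.summable_integral hp ha0 ha
  set ν := volume.restrict (Ioc (-a) a) with hν
  have hνI : ν ≤ μI := Measure.restrict_mono
    (Ioc_subset_Icc_self.trans (Icc_subset_Icc (by linarith) ha.le)) le_rfl
  have hdint : ∀ j, Integrable (dser P (s + 1) j) ν :=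
    fun j => (continuous_dser P (s + 1) j).integrableOn_Ioc
  have hsum' : Summable fun j => ∫ x, ‖dser P (s + 1) j x‖ ∂ν := by
    refine hsum.congr fun j => ?_
    rw [intervalIntegral.integral_of_le (by linarith)]
    rfl
  have hlim := (h'.ae_summable hp)
  have htint : Integrable (fun x => ∑' j, dser P (s + 1) j x) ν := by
    refine ⟨?_, ?_⟩
    · refine aestronglyMeasurable_of_tendsto_ae atTop
        (f := fun n x => ∑ j ∈ Finset.range n, dser P (s + 1) j x) (fun n => ?_) ?_
      · exact (continuous_finsetSum _ fun j _ => continuous_dser P (s + 1) j).aestronglyMeasurable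
      · filter_upwards [ae_mono hνI hlim] with x hx
        exact hx.hasSum.tendsto_sum_nat
    · have h1 : ∑' j, ∫⁻ x, ‖dser P (s + 1) j x‖ₑ ∂ν ≠ ⊤ := by
        have := hsum'.tsum_ofReal_ne_top
        simpa only [ofReal_integral_norm_eq_lintegral_enorm (hdint _)] using this
      rw [← lintegral_tsum (fun j => (hdint j).1.enorm)] at h1
      refine lt_of_le_of_lt (lintegral_mono fun x => ?_) (lt_top_iff_ne_top.2 h1)
      exact enorm_tsum_le_tsum_enorm
  have hPint : Continuous (fun x => (Polynomial.derivative^[s + 1] (P 0)).eval x) :=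
    Polynomial.continuous _
  refine ⟨?_, fun x hx => ?_⟩
  · rw [intervalIntegrable_iff_integrableOn_Ioc_of_le (by linarith)]
    exact (hPint.integrableOn_Ioc (μ := volume)).add htint
  · have h0 : (0 : ℝ) ∈ Icc (-a) a := ⟨by linarith, ha0.le⟩
    have hsub : uIoc 0 x ⊆ Ioc (-a) a := by
      intro u hu
      rcases le_total 0 x with hx0 | hx0
      · rw [uIoc_of_le hx0] at hu
        exact ⟨by linarith [hu.1], hu.2.trans hx.2⟩
      · rw [uIoc_of_ge hx0] at hu
        exact ⟨hx.1.trans_lt hu.1, by linarith [hu.2]⟩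
    have hle : volume.restrict (uIoc 0 x) ≤ ν := Measure.restrict_mono hsub le_rfl
    have key : HasSum (fun j => ∫ y in (0 : ℝ)..x, dser P (s + 1) j y)
        (∫ y in (0 : ℝ)..x, ∑' j, dser P (s + 1) j y) := by
      have h1 := hasSum_integral_of_summable_integral_norm
        (fun j => (hdint j).mono_measure hle) (by
          refine Summable.of_nonneg_of_le (fun j => by positivity) (fun j => ?_) hsum'
          exact integral_mono_measure hle (ae_of_all _ fun _ => norm_nonneg _) (hdint j).norm)
      simp only [intervalIntegral.intervalIntegral_eq_integral_uIoc]
      exact h1.const_smul _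
    have hd : ∀ j, ∫ y in (0 : ℝ)..x, dser P (s + 1) j y = dser P s j x - dser P s j 0 :=
      fun j => intervalIntegral.integral_eq_sub_of_hasDerivAt (fun u _ => hasDerivAt_dser P s j u)
        ((continuous_dser P (s + 1) j).intervalIntegrable _ _)
    simp only [hd] at key
    have s1 := summable_dser hp h h' (x := x) ⟨by linarith [hx.1], by linarith [hx.2]⟩
    have s2 := summable_dser hp h h' (x := 0) ⟨by linarith, by linarith⟩
    have hP0 : ∫ y in (0 : ℝ)..x, (Polynomial.derivative^[s + 1] (P 0)).eval y =
        (Polynomial.derivative^[s] (P 0)).eval x - (Polynomial.derivative^[s] (P 0)).eval 0 := by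
      refine intervalIntegral.integral_eq_sub_of_hasDerivAt
        (f := fun y => (Polynomial.derivative^[s] (P 0)).eval y) (fun u _ => ?_)
        (hPint.intervalIntegrable _ _)
      have h2 := (Polynomial.derivative^[s] (P 0)).hasDerivAt u
      rwa [← Function.iterate_succ_apply' Polynomial.derivative] at h2
    have e := key.unique (s1.hasSum.sub s2.hasSum)
    have hti : IntervalIntegrable (fun x => ∑' j, dser P (s + 1) j x) volume 0 x :=
      intervalIntegrable_iff.2 (htint.mono_measure hle)
    simp only [limFun]
    rw [intervalIntegral.integral_add (hPint.intervalIntegrable _ _) hti, hP0, e]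
    ring

end AlgApprox

/-! ### Regularity of the limit function and its identification with f -/

namespace AlgApprox

open Filter Topology

lemma continuousOn_limFun {P : ℕ → Polynomial ℝ} {p : ℝ≥0∞} {s : ℕ} (hp : 1 ≤ p)
    (h : WSummable P p s) (h' : WSummable P p (s + 1)) :
    ContinuousOn (limFun P s) (Ioo (-1) 1) := by
  intro x hx
  obtain ⟨a, ha0, ha, hxa⟩ := exists_mem_Ioo_neg hx
  obtain ⟨hint, heq⟩ := integrable_limFun_and_eq hp h h' ha0 ha
  have h1 := intervalIntegral.continuousOn_primitive_interval' (a := 0) hint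
    (by rw [uIcc_of_le (by linarith)]; exact ⟨by linarith, ha0.le⟩)
  rw [uIcc_of_le (by linarith)] at h1
  have h2 : ContinuousOn (limFun P s) (Icc (-a) a) :=
    (continuousOn_const.add h1).congr heq
  exact (h2.continuousAt (Icc_mem_nhds hxa.1 hxa.2)).continuousWithinAt

lemma contDiffOn_limFun {P : ℕ → Polynomial ℝ} {p : ℝ≥0∞} {r : ℕ} (hp : 1 ≤ p)
    (h : ∀ s ≤ r, WSummable P p s) (m : ℕ) :
    ∀ s, s + m < r → ContDiffOn ℝ (m : ℕ∞ω) (limFun P s) (Ioo (-1) 1) := by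
  induction m with
  | zero =>
    intro s hs
    rw [Nat.cast_zero, contDiffOn_zero]
    exact continuousOn_limFun hp (h s (by omega)) (h (s + 1) (by omega))
  | succ m ih =>
    intro s hs
    have hd : ∀ x ∈ Ioo (-1 : ℝ) 1, HasDerivAt (limFun P s) (limFun P (s + 1) x) x :=
      fun x hx => hasDerivAt_limFun hp (h s (by omega)) (h (s + 1) (by omega))
        (h (s + 2) (by omega)) hx
    push_cast
    rw [contDiffOn_succ_iff_deriv_of_isOpen isOpen_Ioo]
    refine ⟨fun x hx => (hd x hx).differentiableAt.differentiableWithinAt, fun hω => ?_, ?_⟩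
    · exact absurd hω (by simp)
    · exact (ih (s + 1) (by omega)).congr fun x hx => (hd x hx).deriv

lemma iteratedDeriv_limFun {P : ℕ → Polynomial ℝ} {p : ℝ≥0∞} {r : ℕ} (hp : 1 ≤ p)
    (h : ∀ s ≤ r, WSummable P p s) (s : ℕ) (hs : s < r) :
    EqOn (iteratedDeriv s (limFun P 0)) (limFun P s) (Ioo (-1) 1) := by
  induction s with
  | zero => intro x _; rw [iteratedDeriv_zero]
  | succ s ih =>
    intro x hx
    have e : iteratedDeriv s (limFun P 0) =ᶠ[𝓝 x] limFun P s :=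
      (ih (by omega)).eventuallyEq_of_mem (isOpen_Ioo.mem_nhds hx)
    rw [iteratedDeriv_succ, e.deriv_eq]
    exact (hasDerivAt_limFun hp (h s (by omega)) (h (s + 1) (by omega))
      (h (s + 2) (by omega)) hx).deriv

/-- Below order r the derivatives are classical; at order r Lebesgue's differentiation theorem
applies to the primitive, on countably many intervals exhausting (-1, 1). -/
lemma ae_iteratedDeriv_limFun {P : ℕ → Polynomial ℝ} {p : ℝ≥0∞} {r : ℕ} (hp : 1 ≤ p)
    (h : ∀ s ≤ r, WSummable P p s) :
    ∀ᵐ x ∂μI, iteratedDeriv r (limFun P 0) x = limFun P r x := by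
  rcases r with _ | s
  · simp
  -- The shift n + 2 keeps the half-length positive already for n = 0.
  have hseq : ∀ n : ℕ, (0 : ℝ) < 1 - 1 / (n + 2) ∧ (1 : ℝ) - 1 / (n + 2) < 1 := by
    intro n
    have : (1 : ℝ) / (n + 2) < 1 := by rw [div_lt_one (by positivity)]; linarith [n.cast_nonneg (α := ℝ)]
    exact ⟨by linarith, by linarith [show (0 : ℝ) < 1 / (n + 2) by positivity]⟩
  have hae : ∀ᵐ x : ℝ, ∀ n : ℕ, x ∈ uIcc (-(1 - 1 / ((n : ℝ) + 2))) (1 - 1 / (n + 2)) →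
      ∀ c ∈ uIcc (-(1 - 1 / ((n : ℝ) + 2))) (1 - 1 / (n + 2)),
        HasDerivAt (fun x => ∫ t in c..x, limFun P (s + 1) t) (limFun P (s + 1) x) x :=
    ae_all_iff.2 fun n => (integrable_limFun_and_eq hp (h s (by omega)) (h (s + 1) le_rfl)
      (hseq n).1 (hseq n).2).1.ae_hasDerivAt_integral
  rw [μI_eq_Ioo]
  filter_upwards [ae_restrict_of_ae hae, ae_restrict_mem measurableSet_Ioo] with x hx hx1
  obtain ⟨n, hn⟩ := exists_nat_one_div_lt (sub_pos.2 (abs_lt.2 hx1))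
  set a : ℝ := 1 - 1 / ((n : ℝ) + 2) with ha
  obtain ⟨ha0, ha1⟩ := hseq n
  have hxa : |x| < a := by
    have : (1 : ℝ) / (n + 2) ≤ 1 / (n + 1) := by gcongr; linarith
    rw [ha]; linarith
  have hxa' := abs_lt.1 hxa
  have hu : uIcc (-a) a = Icc (-a) a := uIcc_of_le (by linarith)
  have hd := hx n (by rw [hu]; exact ⟨hxa'.1.le, hxa'.2.le⟩) 0
    (by rw [hu]; exact ⟨by linarith, ha0.le⟩)
  have heq := (integrable_limFun_and_eq hp (h s (by omega)) (h (s + 1) le_rfl) ha0 ha1).2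
  have e : iteratedDeriv s (limFun P 0) =ᶠ[𝓝 x]
      fun x => limFun P s 0 + ∫ t in (0 : ℝ)..x, limFun P (s + 1) t := by
    filter_upwards [Ioo_mem_nhds hxa'.1 hxa'.2] with y hy
    rw [iteratedDeriv_limFun hp h s (by omega) ⟨by linarith [hy.1], by linarith [hy.2]⟩]
    exact heq y (Ioo_subset_Icc_self hy)
  rw [iteratedDeriv_succ, e.deriv_eq]
  exact (hd.const_add _).deriv

lemma AbsolutelyContinuousOnInterval.congr_uIcc {f g : ℝ → ℝ} {a b : ℝ}
    (hf : AbsolutelyContinuousOnInterval f a b) (hfg : EqOn f g (uIcc a b)) :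
    AbsolutelyContinuousOnInterval g a b := by
  rw [absolutelyContinuousOnInterval_iff] at hf ⊢
  intro ε hε
  obtain ⟨δ, hδ, h⟩ := hf ε hε
  refine ⟨δ, hδ, fun E hE hlt => ?_⟩
  refine lt_of_eq_of_lt (Finset.sum_congr rfl fun i hi => ?_) (h E hE hlt)
  rw [hfg (hE.1 i hi).1, hfg (hE.1 i hi).2]

lemma eLpNorm_phi_mul_limFun_lt_top {P : ℕ → Polynomial ℝ} {p : ℝ≥0∞} {s : ℕ} (hp : 1 ≤ p)
    (h : WSummable P p s) : eLpNorm (fun x => phi x ^ s * limFun P s x) p μI < ⊤ := by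
  have hc0 : Continuous (fun x => phi x ^ s * (Polynomial.derivative^[s] (P 0)).eval x) :=
    continuous_weighted s (Polynomial.continuous _)
  have : IsFiniteMeasure μI := by unfold μI; infer_instance
  have h0 : eLpNorm (fun x => phi x ^ s * (Polynomial.derivative^[s] (P 0)).eval x) p μI < ⊤ := by
    obtain ⟨C, hC⟩ := isCompact_Icc.exists_bound_of_continuousOn
      (hc0.continuousOn (s := Icc (-1 : ℝ) 1))
    refine (MemLp.of_bound hc0.aestronglyMeasurable C ?_).2
    exact ae_restrict_of_forall_mem measurableSet_Icc hC
  refine lt_of_le_of_lt (b := eLpNorm (fun x => phi x ^ s *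
    (Polynomial.derivative^[s] (P 0)).eval x) p μI +
    ∑' j, eLpNorm (fun x => phi x ^ s * dser P s j x) p μI) ?_
    (ENNReal.add_lt_top.2 ⟨h0, lt_top_iff_ne_top.2 h⟩)
  have hcs : ∀ j, Continuous (fun x => phi x ^ s * dser P s j x) :=
    fun j => continuous_weighted s (continuous_dser P s j)
  refine Lp.eLpNorm_le_of_ae_tendsto (u := atTop)
    (f := fun n x => phi x ^ s * (Polynomial.derivative^[s] (P 0)).eval x +
      ∑ j ∈ Finset.range n, phi x ^ s * dser P s j x)
    (Eventually.of_forall fun n => ?_) (fun n => ?_) ?_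
  · refine (eLpNorm_add_le hc0.aestronglyMeasurable
      (continuous_finsetSum _ fun j _ => hcs j).aestronglyMeasurable hp).trans ?_
    gcongr
    have e : (fun x => ∑ j ∈ Finset.range n, phi x ^ s * dser P s j x) =
      ∑ j ∈ Finset.range n, fun x => phi x ^ s * dser P s j x := by ext x; simp
    rw [e]
    exact (eLpNorm_sum_le (fun j _ => (hcs j).aestronglyMeasurable) hp).trans
      (ENNReal.sum_le_tsum _)
  · exact (hc0.add (continuous_finsetSum _ fun j _ => hcs j)).aestronglyMeasurable
  · filter_upwards [h.ae_summable hp] with x hx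
    simp only [← Finset.mul_sum, ← mul_add, limFun]
    exact (hx.hasSum.tendsto_sum_nat.const_add _).const_mul _

/-- The limit of a sequence of polynomials with summable weighted derivatives is in `𝔹_p^r`. -/
theorem memB_limFun {P : ℕ → Polynomial ℝ} {p : ℝ≥0∞} {s : ℕ} (hp : 1 ≤ p)
    (h : ∀ i ≤ s + 1, WSummable P p i) : MemB p (s + 1) (limFun P 0) := by
  refine ⟨contDiffOn_limFun hp h s 0 (by omega), fun a b ha hab hb => ?_, ?_⟩
  · obtain ⟨A, hA0, hA1, haA, hbA⟩ : ∃ A : ℝ, 0 < A ∧ A < 1 ∧ -A ≤ a ∧ b ≤ A := by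
      obtain ⟨A, h1, h2, h3⟩ := exists_mem_Ioo_neg (x := a) ⟨ha, by linarith⟩
      obtain ⟨B, h4, h5, h6⟩ := exists_mem_Ioo_neg (x := b) ⟨by linarith, hb⟩
      exact ⟨max A B, lt_max_of_lt_left h1, max_lt h2 h5,
        by linarith [le_max_left A B, h3.1], by linarith [le_max_right A B, h6.2]⟩
    obtain ⟨hint, heq⟩ := integrable_limFun_and_eq hp (h s (by omega)) (h (s + 1) le_rfl) hA0 hA1
    have hu : uIcc (-A) A = Icc (-A) A := uIcc_of_le (by linarith)
    have hac := hint.absolutelyContinuousOnInterval_intervalIntegral (c := 0)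
      (by rw [hu]; exact ⟨by linarith, hA0.le⟩)
    have hconst : AbsolutelyContinuousOnInterval (fun _ : ℝ => limFun P s 0) (-A) A :=
      contDiffOn_const.absolutelyContinuousOnInterval
    have hsub : uIcc a b ⊆ uIcc (-A) A := by
      rw [hu, uIcc_of_le hab]
      exact Icc_subset_Icc haA hbA
    refine AbsolutelyContinuousOnInterval.congr_uIcc ((hconst.add hac).mono hsub) fun x hx => ?_
    have hx' := hsub hx
    rw [hu] at hx'
    rw [iteratedDeriv_limFun hp h s (by omega) ⟨by linarith [hx'.1], by linarith [hx'.2]⟩,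
      heq x hx']
    rfl
  · have e : eLpNorm (fun x => iteratedDeriv (s + 1) (limFun P 0) x * phi x ^ (s + 1)) p μI =
        eLpNorm (fun x => phi x ^ (s + 1) * limFun P (s + 1) x) p μI := by
      refine eLpNorm_congr_ae ?_
      filter_upwards [ae_iteratedDeriv_limFun hp h] with x hx
      rw [hx, mul_comm]
    rw [e]
    exact eLpNorm_phi_mul_limFun_lt_top hp (h (s + 1) le_rfl)

/-- Fatou's lemma bounds the norm of f minus the pointwise limit by the lower limit of the errors,
which is 0. -/
lemma ae_eq_limFun {P : ℕ → Polynomial ℝ} {p : ℝ≥0∞} (hp : 1 ≤ p) (h : WSummable P p 0)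
    {f : ℝ → ℝ} (hf : MemLp f p μI)
    (hP : Tendsto (fun j => eLpNorm (fun x => f x - (P j).eval x) p μI) atTop (𝓝 0)) :
    f =ᵐ[μI] limFun P 0 := by
  have hlim : ∀ᵐ x ∂μI, Tendsto (fun j => (P j).eval x) atTop (𝓝 (limFun P 0 x)) := by
    filter_upwards [h.ae_summable hp] with x hx
    simpa using tendsto_limFun hx
  have hm : AEStronglyMeasurable (limFun P 0) μI :=
    aestronglyMeasurable_of_tendsto_ae atTop (fun j => (P j).continuous.aestronglyMeasurable) hlim
  have h1 := Lp.eLpNorm_lim_le_liminf_eLpNorm (p := p)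
    (fun j => hf.1.sub (P j).continuous.aestronglyMeasurable) (fun x => f x - limFun P 0 x)
    (by filter_upwards [hlim] with x hx; exact hx.const_sub (f x))
  have h2 : liminf (fun j => eLpNorm (f - fun x => (P j).eval x) p μI) atTop = 0 := hP.liminf_eq
  rw [h2, le_zero_iff] at h1
  have h3 := (eLpNorm_eq_zero_iff (hf.1.sub hm) (zero_lt_one.trans_le hp).ne').1 h1
  filter_upwards [h3] with x hx
  exact sub_eq_zero.1 hx

theorem exists_memB {P : ℕ → Polynomial ℝ} {p : ℝ≥0∞} {r : ℕ} (hp : 1 ≤ p)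
    (h : ∀ s ≤ r, WSummable P p s) {f : ℝ → ℝ} (hf : MemLp f p μI)
    (hP : Tendsto (fun j => eLpNorm (fun x => f x - (P j).eval x) p μI) atTop (𝓝 0)) :
    ∃ g : ℝ → ℝ, g =ᵐ[μI] f ∧ MemB p r g := by
  rcases r with _ | s
  · exact ⟨f, Filter.EventuallyEq.rfl, hf⟩
  · exact ⟨limFun P 0, (ae_eq_limFun hp (h 0 (by omega)) hf hP).symm, memB_limFun hp h⟩

theorem ae_tendsto_iteratedDeriv {P : ℕ → Polynomial ℝ} {p : ℝ≥0∞} {r : ℕ} (hp : 1 ≤ p)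
    (h : ∀ s ≤ r, WSummable P p s) {f : ℝ → ℝ} (hf : MemLp f p μI)
    (hP : Tendsto (fun j => eLpNorm (fun x => f x - (P j).eval x) p μI) atTop (𝓝 0))
    {g : ℝ → ℝ} (hgf : g =ᵐ[μI] f) (hg : MemB p r g) :
    ∀ᵐ x ∂μI, Tendsto (fun j => (Polynomial.derivative^[r] (P j)).eval x) atTop
      (𝓝 (iteratedDeriv r g x)) := by
  have hgl : g =ᵐ[μI] limFun P 0 := hgf.trans (ae_eq_limFun hp (h 0 (by omega)) hf hP)
  have key : ∀ᵐ x ∂μI, iteratedDeriv r g x = limFun P r x := by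
    rcases r with _ | s
    · filter_upwards [hgl] with x hx
      rwa [iteratedDeriv_zero]
    · rw [μI_eq_Ioo] at hgl
      -- Two continuous functions that agree almost everywhere on an open interval agree everywhere
      -- on it, so all their derivatives agree too. This is why the choice of representative is
      -- immaterial.
      have h1 : EqOn g (limFun P 0) (Ioo (-1) 1) :=
        Measure.eqOn_open_of_ae_eq hgl isOpen_Ioo hg.1.continuousOn
          (continuousOn_limFun hp (h 0 (by omega)) (h 1 (by omega)))
      have h2 : ∀ᵐ x ∂μI, x ∈ Ioo (-1 : ℝ) 1 := by
        rw [μI_eq_Ioo]; exact ae_restrict_mem measurableSet_Ioo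
      filter_upwards [ae_iteratedDeriv_limFun hp h, h2] with x hx hx1
      rw [h1.iteratedDeriv_of_isOpen isOpen_Ioo (s + 1) hx1, hx]
  filter_upwards [key, (h r le_rfl).ae_summable hp] with x hx hs
  rw [hx]
  exact tendsto_limFun hs

end AlgApprox

namespace AlgApprox

open Filter Topology

/-! ### The inverse theorem -/

lemma freeDiff_add (k : ℕ) (h : ℝ) (F G : ℝ → ℝ) (x : ℝ) :
    freeDiff k h (fun x => F x + G x) x = freeDiff k h F x + freeDiff k h G x := by
  simp only [freeDiff, ← Finset.sum_add_distrib]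
  exact Finset.sum_congr rfl fun i _ => by ring

lemma continuous_wt_freeDiff (k r : ℕ) (h : ℝ) {F : ℝ → ℝ} (hF : Continuous F) :
    Continuous (fun x => wt (k * h) x ^ r * freeDiff k h F x) := by
  have h1 := continuous_wt (k * h)
  have h2 := continuous_phi
  unfold freeDiff
  fun_prop

/-- Fatou's lemma again. Convergence at the shifted nodes holds almost everywhere because shifts
push Lebesgue measure to at most twice itself, so preimages of null sets are null. -/
lemma eLpNorm_symmDiffK_le_of_ae_tendsto (k r : ℕ) {h : ℝ} (hh : 0 ≤ h) {p : ℝ≥0∞}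
    {F : ℕ → ℝ → ℝ} (hF : ∀ j, Continuous (F j)) {G : ℝ → ℝ}
    (hlim : ∀ᵐ x ∂μI, Tendsto (fun j => F j x) atTop (𝓝 (G x))) {B : ℝ≥0∞}
    (hB : ∀ j, eLpNorm (fun x => wt (k * h) x ^ r * symmDiffK k (h * phi x) (F j) x) p μI ≤ B) :
    eLpNorm (fun x => wt (k * h) x ^ r * symmDiffK k (h * phi x) G x) p μI ≤ B := by
  simp only [eLpNorm_wt_symmDiffK] at hB ⊢
  refine Lp.eLpNorm_le_of_ae_tendsto (u := atTop) (Eventually.of_forall hB)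
    (fun j => (continuous_wt_freeDiff k r h (hF j)).aestronglyMeasurable) ?_
  have hshift : ∀ᵐ x ∂(volume.restrict (diffDom (k * h / 2))), ∀ i : Finset.range (k + 1),
      Tendsto (fun j => F j (x + (((i : ℕ) : ℝ) - (k : ℝ) / 2) * h * phi x)) atTop
        (𝓝 (G (x + (((i : ℕ) : ℝ) - (k : ℝ) / 2) * h * phi x))) := by
    refine ae_all_iff.2 fun i => ?_
    have hmap := map_shift_le (abs_node_le i.2 hh)
    have h1 : ∀ᵐ x ∂((2 : ℝ≥0∞) • μI), Tendsto (fun j => F j x) atTop (𝓝 (G x)) :=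
      Measure.ae_smul_measure hlim 2
    exact ae_of_ae_map (continuous_shift _).measurable.aemeasurable (ae_mono hmap h1)
  filter_upwards [hshift] with x hx
  refine Tendsto.const_mul _ ?_
  unfold freeDiff
  exact tendsto_finsetSum _ fun i hi => (hx ⟨i, hi⟩).const_mul _

lemma eLpNorm_symmDiffK_le_sum (k r : ℕ) (h : ℝ) {p : ℝ≥0∞} (hp : 1 ≤ p)
    (P : ℕ → Polynomial ℝ) (n : ℕ) :
    eLpNorm (fun x => wt (k * h) x ^ r * symmDiffK k (h * phi x)
        (fun x => (Polynomial.derivative^[r] (P n)).eval x) x) p μI ≤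
      eLpNorm (fun x => wt (k * h) x ^ r * symmDiffK k (h * phi x)
        (fun x => (Polynomial.derivative^[r] (P 0)).eval x) x) p μI +
      ∑ j ∈ Finset.range n, eLpNorm (fun x => wt (k * h) x ^ r * symmDiffK k (h * phi x)
        (fun x => (Polynomial.derivative^[r] (P (j + 1) - P j)).eval x) x) p μI := by
  simp only [eLpNorm_wt_symmDiffK]
  induction n with
  | zero => simp
  | succ n ih =>
    rw [Finset.sum_range_succ, ← add_assoc]
    refine le_trans ?_ (add_le_add_left ih _)
    refine le_trans (le_of_eq ?_) (eLpNorm_add_le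
      (continuous_wt_freeDiff k r h (Polynomial.continuous _)).aestronglyMeasurable
      (continuous_wt_freeDiff k r h (Polynomial.continuous _)).aestronglyMeasurable hp)
    congr 1
    ext x
    rw [Pi.add_apply, ← mul_add, ← freeDiff_add]
    simp only [Polynomial.iterate_derivative_sub, Polynomial.eval_sub, add_sub_cancel]

/-- The constant in the bounds for weighted differences of polynomials. -/
noncomputable def diffConst (k r : ℕ) : ℝ := 2 ^ (k + 2) * 4 ^ (k + r) * (k : ℝ) ^ k

lemma diffConst_pos {k : ℕ} (hk : 1 ≤ k) (r : ℕ) : 0 < diffConst k r := by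
  unfold diffConst
  have : (0 : ℝ) < k := by exact_mod_cast hk
  positivity

/-- Weighted differences of `Q` when `Q` agrees with `R` up to degree `< k + r`. -/
lemma eLpNorm_symmDiffK_le_pow {k : ℕ} (hk : 1 ≤ k) (r : ℕ) {h : ℝ} (hh : 0 ≤ h) {p : ℝ≥0∞}
    (hp : 1 ≤ p) {Q R : Polynomial ℝ} {n : ℕ} (hR : R.degree < n)
    (hQR : Polynomial.derivative^[k + r] Q = Polynomial.derivative^[k + r] R) :
    eLpNorm (fun x => wt (k * h) x ^ r * symmDiffK k (h * phi x)
        (fun x => (Polynomial.derivative^[r] Q).eval x) x) p μI ≤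
      ENNReal.ofReal (diffConst k r * n ^ r * (n * h) ^ k) *
        eLpNorm (fun x => R.eval x) p μI := by
  obtain ⟨m, rfl⟩ := Nat.exists_eq_add_of_le' hk
  have h1 := eLpNorm_symmDiffK_le_derivative m r hh hp (Polynomial.derivative^[r] Q)
  rw [← Function.iterate_add_apply, hQR] at h1
  have h2 := bernstein p hp R n hR (m + 1 + r)
  refine h1.trans ?_
  calc _ ≤ 2 ^ (m + 1) * (ENNReal.ofReal (2 * ((m + 1 : ℕ) * h / 2) ^ (m + 1)) * (2 *
        (ENNReal.ofReal ((4 * n) ^ (m + 1 + r)) * eLpNorm (fun x => R.eval x) p μI))) := by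
        gcongr
    _ = ENNReal.ofReal (2 ^ (m + 1) * ((2 * ((m + 1 : ℕ) * h / 2) ^ (m + 1)) *
          (2 * (4 * n) ^ (m + 1 + r)))) * eLpNorm (fun x => R.eval x) p μI := by
        rw [ENNReal.ofReal_mul (p := (2 : ℝ) ^ (m + 1)) (by positivity),
          ENNReal.ofReal_mul (p := 2 * ((m + 1 : ℕ) * h / 2) ^ (m + 1)) (by positivity),
          ENNReal.ofReal_mul (q := (4 * (n : ℝ)) ^ (m + 1 + r)) zero_le_two,
          ENNReal.ofReal_pow zero_le_two, ENNReal.ofReal_ofNat]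
        ring
    _ ≤ _ := by
        refine mul_le_mul_left (ENNReal.ofReal_le_ofReal ?_) _
        -- `diffConst` is larger than needed here by the factor 2^(m+1), so that it also covers the
        -- bound without smoothness.
        have e : (2 : ℝ) ^ (m + 1) * ((2 * ((m + 1 : ℕ) * h / 2) ^ (m + 1)) *
          (2 * (4 * n) ^ (m + 1 + r))) = (2 : ℝ)⁻¹ ^ (m + 1) *
          (diffConst (m + 1) r * n ^ r * (n * h) ^ (m + 1)) := by
          unfold diffConst
          have : (2 : ℝ) ^ (m + 1) * 2⁻¹ ^ (m + 1) = 1 := by rw [← mul_pow]; norm_num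
          rw [div_eq_mul_inv, mul_pow _ (2⁻¹ : ℝ)]
          ring
        rw [e]
        refine mul_le_of_le_one_left ?_ (pow_le_one₀ (by norm_num) (by norm_num))
        have := (diffConst_pos hk r).le
        positivity

/-- For nh ≥ 1 smoothness gains nothing and the crude bound is used; otherwise k further derivatives
are spent. -/
lemma eLpNorm_symmDiffK_le_min {k : ℕ} (hk : 1 ≤ k) (r : ℕ) {h : ℝ} (hh : 0 ≤ h) {p : ℝ≥0∞}
    (hp : 1 ≤ p) {Q : Polynomial ℝ} {n : ℕ} (hQ : Q.degree < n) :
    eLpNorm (fun x => wt (k * h) x ^ r * symmDiffK k (h * phi x)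
        (fun x => (Polynomial.derivative^[r] Q).eval x) x) p μI ≤
      ENNReal.ofReal (diffConst k r * n ^ r * min 1 ((n * h) ^ k)) *
        eLpNorm (fun x => Q.eval x) p μI := by
  rcases le_total 1 ((n * h) ^ k) with hle | hle
  · rw [min_eq_left hle, mul_one]
    refine (eLpNorm_symmDiffK_le k r hh hp (Polynomial.continuous _)).trans ?_
    have h2 := bernstein p hp Q n hQ r
    calc _ ≤ 2 ^ k * (2 * (ENNReal.ofReal ((4 * n) ^ r) * eLpNorm (fun x => Q.eval x) p μI)) := by
          gcongr
      _ = ENNReal.ofReal (2 ^ k * (2 * (4 * n) ^ r)) * eLpNorm (fun x => Q.eval x) p μI := by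
          rw [ENNReal.ofReal_mul (by positivity), ENNReal.ofReal_mul zero_le_two,
            ENNReal.ofReal_pow zero_le_two, ENNReal.ofReal_ofNat]
          ring
      _ ≤ _ := by
          refine mul_le_mul_left (ENNReal.ofReal_le_ofReal ?_) _
          unfold diffConst
          have hk1 : (1 : ℝ) ≤ (k : ℝ) ^ k := one_le_pow₀ (by exact_mod_cast hk)
          have h4 : (1 : ℝ) ≤ 4 ^ k := one_le_pow₀ (by norm_num)
          calc (2 : ℝ) ^ k * (2 * (4 * n) ^ r) = 2 ^ (k + 1) * (1 * 4 ^ r) * 1 * n ^ r := by ring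
            _ ≤ 2 ^ (k + 2) * (4 ^ k * 4 ^ r) * (k : ℝ) ^ k * n ^ r := by
                gcongr <;> norm_num
            _ = _ := by ring
  · rw [min_eq_right hle]
    exact eLpNorm_symmDiffK_le_pow hk r hh hp hQ rfl

/-- The dyadic sum of the inverse theorem. -/
lemma exists_dyadic_sum_le (k : ℕ) {β : ℝ} (hβ : 0 < β) (hβk : β < k) :
    ∃ A : ℝ, 0 ≤ A ∧ ∀ t : ℝ, 0 < t → ∀ n : ℕ,
      ∑ i ∈ Finset.range n, ((2 : ℝ) ^ i) ^ (-β) * min 1 ((2 ^ i * t) ^ k) ≤ A * t ^ β := by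
  set γ : ℝ := k - β with hγ
  have hγ0 : 0 < γ := by linarith
  have hb : (1 : ℝ) < 2 ^ γ := Real.one_lt_rpow one_lt_two hγ0
  have ha : (2 : ℝ) ^ (-β) < 1 := Real.rpow_lt_one_of_one_lt_of_neg one_lt_two (by linarith)
  have ha0 : (0 : ℝ) < 2 ^ (-β) := by positivity
  refine ⟨2 ^ γ / (2 ^ γ - 1) + 1 / (1 - 2 ^ (-β)), ?_, fun t ht n => ?_⟩
  · have := sub_pos.2 hb
    have := sub_pos.2 ha
    positivity
  have hex : ∃ J : ℕ, 1 ≤ 2 ^ J * t := by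
    obtain ⟨J, hJ⟩ := pow_unbounded_of_one_lt t⁻¹ (one_lt_two (α := ℝ))
    exact ⟨J, by rw [← inv_le_iff_one_le_mul₀ ht]; exact hJ.le⟩
  classical
  -- J is the first index with 2^J t ≥ 1. Before it the terms are bounded by a geometric sequence of
  -- ratio 2^(k-β) > 1, after it by one of ratio 2^(-β) < 1, and both are of size t^β near J. If J =
  -- 0 the first range is empty.
  obtain ⟨J, hJ, hJmin⟩ : ∃ J : ℕ, 1 ≤ 2 ^ J * t ∧ (J ≠ 0 → 2 ^ J * t ≤ 2) := by
    refine ⟨Nat.find hex, Nat.find_spec hex, fun h0 => ?_⟩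
    obtain ⟨i, hi⟩ := Nat.exists_eq_succ_of_ne_zero h0
    have := Nat.find_min hex (m := i) (by omega)
    rw [hi, Nat.succ_eq_add_one, pow_succ]
    linarith
  have hnn : ∀ i : ℕ, 0 ≤ ((2 : ℝ) ^ i) ^ (-β) * min 1 ((2 ^ i * t) ^ k) := fun i => by positivity
  have hpow : ∀ (i : ℕ) (z : ℝ), ((2 : ℝ) ^ i) ^ z = ((2 : ℝ) ^ z) ^ i := fun i z => by
    rw [← Real.rpow_natCast, ← Real.rpow_natCast, ← Real.rpow_mul zero_le_two,
      ← Real.rpow_mul zero_le_two, mul_comm]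
  have htt : ∀ i : ℕ, ((2 : ℝ) ^ i) ^ (-β) * (2 ^ i * t) ^ k = t ^ k * (2 ^ γ) ^ i := by
    intro i
    rw [mul_pow, ← hpow, hγ, sub_eq_add_neg, Real.rpow_add (by positivity), Real.rpow_natCast]
    ring
  have hs1 : ∑ i ∈ Finset.range J, ((2 : ℝ) ^ i) ^ (-β) * min 1 ((2 ^ i * t) ^ k) ≤
      2 ^ γ / (2 ^ γ - 1) * t ^ β := by
    have hd := sub_pos.2 hb
    rcases eq_or_ne J 0 with rfl | hJ0
    · simp only [Finset.range_zero, Finset.sum_empty]; positivity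
    calc _ ≤ ∑ i ∈ Finset.range J, t ^ k * ((2 : ℝ) ^ γ) ^ i := by
          refine Finset.sum_le_sum fun i _ => ?_
          rw [← htt]
          gcongr
          exact min_le_right _ _
      _ = t ^ k * (((2 : ℝ) ^ γ) ^ J - 1) / (2 ^ γ - 1) := by
          rw [← Finset.mul_sum, geom_sum_eq hb.ne', mul_div_assoc]
      _ ≤ (2 ^ γ * t ^ β) / (2 ^ γ - 1) := by
          refine div_le_div_of_nonneg_right ?_ hd.le
          calc t ^ k * (((2 : ℝ) ^ γ) ^ J - 1) ≤ t ^ k * ((2 : ℝ) ^ γ) ^ J := by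
                gcongr; linarith
            _ = (2 ^ J * t) ^ γ * t ^ β := by
                have : t ^ k = t ^ γ * t ^ β := by
                  rw [← Real.rpow_add ht, hγ, sub_add_cancel, Real.rpow_natCast]
                rw [this, Real.mul_rpow (by positivity) ht.le, hpow]
                ring
            _ ≤ 2 ^ γ * t ^ β := by
                gcongr
                exact hJmin hJ0
      _ = _ := by ring
  have hs2 : ∑ i ∈ Finset.range n, ((2 : ℝ) ^ (J + i)) ^ (-β) * min 1 ((2 ^ (J + i) * t) ^ k) ≤
      1 / (1 - 2 ^ (-β)) * t ^ β := by
    have hd := sub_pos.2 ha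
    calc _ ≤ ∑ i ∈ Finset.range n, t ^ β * ((2 : ℝ) ^ (-β)) ^ i := by
          refine Finset.sum_le_sum fun i _ => ?_
          refine (mul_le_of_le_one_right (by positivity) (min_le_left _ _)).trans ?_
          rw [hpow, pow_add]
          gcongr
          rw [← hpow, Real.rpow_neg (by positivity), inv_le_iff_one_le_mul₀ (by positivity),
            ← Real.mul_rpow ht.le (by positivity), mul_comm]
          exact Real.one_le_rpow hJ hβ.le
      _ = t ^ β * ((1 - ((2 : ℝ) ^ (-β)) ^ n) / (1 - 2 ^ (-β))) := by
          rw [← Finset.mul_sum, geom_sum_eq ha.ne]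
          congr 1
          rw [← neg_sub, ← neg_sub (1 : ℝ) (2 ^ (-β)), neg_div_neg_eq]
      _ ≤ t ^ β * (1 / (1 - 2 ^ (-β))) := by
          gcongr
          linarith [pow_pos ha0 n]
      _ = _ := mul_comm _ _
  calc _ ≤ ∑ i ∈ Finset.range (J + n), ((2 : ℝ) ^ i) ^ (-β) * min 1 ((2 ^ i * t) ^ k) :=
        Finset.sum_le_sum_of_subset_of_nonneg (Finset.range_mono (by omega)) fun i _ _ => hnn i
    _ ≤ _ := by
        rw [Finset.sum_range_add, add_mul]
        exact add_le_add hs1 hs2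

/-! ### Near-best approximation at dyadic degrees -/

lemma bestApprox_anti {m n : ℕ} (h : m ≤ n) (p : ℝ≥0∞) (f : ℝ → ℝ) :
    bestApprox n p f ≤ bestApprox m p f :=
  le_iInf₂ fun P hP => iInf₂_le P (hP.trans_le (by exact_mod_cast h))

lemma exists_of_bestApprox_lt {n : ℕ} {p : ℝ≥0∞} {f : ℝ → ℝ} {x : ℝ≥0∞}
    (h : bestApprox n p f < x) :
    ∃ P : Polynomial ℝ, P.degree < (n : WithBot ℕ) ∧
      eLpNorm (fun y => f y - P.eval y) p μI < x := by
  simp only [bestApprox, iInf_lt_iff] at h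
  obtain ⟨P, hP, h⟩ := h
  exact ⟨P, hP, h⟩

lemma eLpNorm_eval_sub_le {p : ℝ≥0∞} (hp : 1 ≤ p) {f : ℝ → ℝ} (hf : MemLp f p μI)
    (P Q : Polynomial ℝ) :
    eLpNorm (fun x => (P - Q).eval x) p μI ≤
      eLpNorm (fun x => f x - P.eval x) p μI + eLpNorm (fun x => f x - Q.eval x) p μI := by
  have h := eLpNorm_sub_le (hf.1.sub Q.continuous.aestronglyMeasurable)
    (hf.1.sub P.continuous.aestronglyMeasurable) hp
  rw [add_comm]
  refine le_trans (le_of_eq ?_) h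
  congr 1
  ext x
  simp

/-- Near-best polynomials of dyadic degrees, the first of which is also near-best of low degree. -/
lemma exists_dyadic_approx {α : ℝ} {p : ℝ≥0∞} {f : ℝ → ℝ} {N l : ℕ} (hlN : l ≤ N)
    (hE : ∀ n : ℕ, N ≤ n → bestApprox n p f ≤ ENNReal.ofReal ((n : ℝ) ^ (-α)))
    {y : ℝ≥0∞} (hy : bestApprox l p f < y) :
    ∃ P : ℕ → Polynomial ℝ, (∀ j, (P j).degree < ((2 ^ (N + j) : ℕ) : WithBot ℕ)) ∧
      (∀ j, eLpNorm (fun x => f x - (P j).eval x) p μI ≤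
        ENNReal.ofReal (2 * ((2 : ℝ) ^ (N + j)) ^ (-α))) ∧
      eLpNorm (fun x => f x - (P 0).eval x) p μI ≤ y := by
  -- Starting at exponent N makes the hypothesis available at every level. The factor 2 in the error
  -- provides strict inequality, so the infimum need not be attained.
  have hN : ∀ j, N ≤ 2 ^ (N + j) := fun j => (Nat.le_add_right N j).trans Nat.lt_two_pow_self.le
  have h1 : ∀ j, bestApprox (2 ^ (N + j)) p f < ENNReal.ofReal (2 * ((2 : ℝ) ^ (N + j)) ^ (-α)) := by
    intro j
    refine (hE _ (hN j)).trans_lt ?_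
    push_cast
    have : (0 : ℝ) < ((2 : ℝ) ^ (N + j)) ^ (-α) := by positivity
    exact (ENNReal.ofReal_lt_ofReal_iff (by positivity)).2 (by linarith)
  -- The first polynomial must meet two bounds at once: the dyadic rate and y. The second is
  -- possible since l ≤ 2^N.
  have h0 : bestApprox (2 ^ (N + 0)) p f < min y (ENNReal.ofReal (2 * ((2 : ℝ) ^ (N + 0)) ^ (-α))) :=
    lt_min ((bestApprox_anti (hlN.trans (hN 0)) p f).trans_lt hy) (h1 0)
  choose P hPd hPe using fun j => exists_of_bestApprox_lt (h1 j)
  obtain ⟨P0, hP0d, hP0e⟩ := exists_of_bestApprox_lt h0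
  refine ⟨fun j => if j = 0 then P0 else P j, fun j => ?_, fun j => ?_, ?_⟩
  · rcases eq_or_ne j 0 with rfl | hj
    · simpa using hP0d
    · simpa [hj] using hPd j
  · rcases eq_or_ne j 0 with rfl | hj
    · simpa using (hP0e.trans_le (min_le_right _ _)).le
    · simpa [hj] using (hPe j).le
  · simpa using (hP0e.trans_le (min_le_left _ _)).le

end AlgApprox

namespace AlgApprox

open Filter Topology

lemma two_pow_rpow (i : ℕ) (z : ℝ) : ((2 : ℝ) ^ i) ^ z = ((2 : ℝ) ^ z) ^ i := by
  rw [← Real.rpow_natCast, ← Real.rpow_natCast, ← Real.rpow_mul zero_le_two,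
    ← Real.rpow_mul zero_le_two, mul_comm]

section Dyadic

variable {α : ℝ} {p : ℝ≥0∞} {f : ℝ → ℝ} {N : ℕ} {P : ℕ → Polynomial ℝ}

lemma degree_dyadic_sub_lt
    (hPd : ∀ j, (P j).degree < ((2 ^ (N + j) : ℕ) : WithBot ℕ)) (j : ℕ) :
    (P (j + 1) - P j).degree < ((2 ^ (N + j + 1) : ℕ) : WithBot ℕ) := by
  refine (Polynomial.degree_sub_le _ _).trans_lt (max_lt (hPd (j + 1)) ((hPd j).trans_le ?_))
  exact_mod_cast Nat.pow_le_pow_right two_pos (Nat.le_succ _)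

/-- Two errors at levels N + j and N + j + 1; the factor 2^α restates the coarser one in terms of
the degree bound 2^(N+j+1) of the difference. -/
lemma eLpNorm_dyadic_sub_le (hα : 0 < α) (hp : 1 ≤ p) (hf : MemLp f p μI)
    (hPe : ∀ j, eLpNorm (fun x => f x - (P j).eval x) p μI ≤
      ENNReal.ofReal (2 * ((2 : ℝ) ^ (N + j)) ^ (-α))) (j : ℕ) :
    eLpNorm (fun x => (P (j + 1) - P j).eval x) p μI ≤
      ENNReal.ofReal (4 * 2 ^ α * ((2 : ℝ) ^ (N + j + 1)) ^ (-α)) := by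
  refine (eLpNorm_eval_sub_le hp hf _ _).trans ((add_le_add (hPe (j + 1)) (hPe j)).trans ?_)
  rw [← ENNReal.ofReal_add (by positivity) (by positivity)]
  refine ENNReal.ofReal_le_ofReal ?_
  have h1 : ((2 : ℝ) ^ (N + j + 1)) ^ (-α) = ((2 : ℝ) ^ (N + j)) ^ (-α) * 2 ^ (-α) := by
    rw [pow_succ, Real.mul_rpow (by positivity) zero_le_two]
  have h2 : (2 : ℝ) ^ α * 2 ^ (-α) = 1 := by
    rw [← Real.rpow_add two_pos, add_neg_cancel, Real.rpow_zero]
  have h3 : (2 : ℝ) ^ (-α) ≤ 1 := Real.rpow_le_one_of_one_le_of_nonpos one_le_two (by linarith)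
  have h4 : 0 < ((2 : ℝ) ^ (N + j)) ^ (-α) := by positivity
  rw [← add_assoc, h1]
  calc _ ≤ 4 * ((2 : ℝ) ^ (N + j)) ^ (-α) := by nlinarith
    _ = 4 * ((2 : ℝ) ^ α * 2 ^ (-α)) * ((2 : ℝ) ^ (N + j)) ^ (-α) := by rw [h2, mul_one]
    _ ≤ _ := le_of_eq (by ring)

lemma tendsto_dyadic (hα : 0 < α)
    (hPe : ∀ j, eLpNorm (fun x => f x - (P j).eval x) p μI ≤
      ENNReal.ofReal (2 * ((2 : ℝ) ^ (N + j)) ^ (-α))) :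
    Tendsto (fun j => eLpNorm (fun x => f x - (P j).eval x) p μI) atTop (𝓝 0) := by
  refine tendsto_of_tendsto_of_tendsto_of_le_of_le tendsto_const_nhds ?_ (fun _ => zero_le) hPe
  have hlt : (2 : ℝ) ^ (-α) < 1 := Real.rpow_lt_one_of_one_lt_of_neg one_lt_two (by linarith)
  have h1 : Tendsto (fun j => 2 * (((2 : ℝ) ^ (-α)) ^ (N + j))) atTop (𝓝 (2 * 0)) := by
    refine Tendsto.const_mul _ ((tendsto_pow_atTop_nhds_zero_of_lt_one (by positivity) hlt).comp ?_)
    exact tendsto_atTop_mono (fun j => Nat.le_add_left j N) tendsto_id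
  have h2 := ENNReal.tendsto_ofReal h1
  simpa only [two_pow_rpow, mul_zero, ENNReal.ofReal_zero] using h2

/-- Bernstein turns the rate n^(-α) into n^(s-α) ≤ n^(r-α), a geometric series in dyadic n. -/
lemma wSummable_dyadic {r s : ℕ} (hα : (r : ℝ) < α) (hs : s ≤ r) (hp : 1 ≤ p)
    (hf : MemLp f p μI) (hPd : ∀ j, (P j).degree < ((2 ^ (N + j) : ℕ) : WithBot ℕ))
    (hPe : ∀ j, eLpNorm (fun x => f x - (P j).eval x) p μI ≤
      ENNReal.ofReal (2 * ((2 : ℝ) ^ (N + j)) ^ (-α))) : WSummable P p s := by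
  have hα0 : 0 < α := (Nat.cast_nonneg r).trans_lt hα
  have hb : ∀ j, eLpNorm (fun x => phi x ^ s * dser P s j x) p μI ≤
      ENNReal.ofReal (4 ^ s * (4 * 2 ^ α) * ((2 : ℝ) ^ ((r : ℝ) - α)) ^ (N + j + 1)) := by
    intro j
    refine (bernstein p hp _ _ (degree_dyadic_sub_lt hPd j) s).trans ?_
    refine (mul_le_mul_right (eLpNorm_dyadic_sub_le hα0 hp hf hPe j) _).trans ?_
    rw [← ENNReal.ofReal_mul (by positivity)]
    refine ENNReal.ofReal_le_ofReal ?_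
    rw [← two_pow_rpow, sub_eq_add_neg, Real.rpow_add (by positivity), Real.rpow_natCast]
    push_cast
    rw [mul_pow]
    calc _ = 4 ^ s * (4 * 2 ^ α) * (((2 : ℝ) ^ (N + j + 1)) ^ s *
          ((2 : ℝ) ^ (N + j + 1)) ^ (-α)) := by ring
      _ ≤ _ := by
          gcongr
          exact one_le_pow₀ one_le_two
  refine ne_top_of_le_ne_top ?_ (ENNReal.tsum_le_tsum hb)
  refine Summable.tsum_ofReal_ne_top (Summable.mul_left _ ?_)
  have hlt : (2 : ℝ) ^ ((r : ℝ) - α) < 1 :=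
    Real.rpow_lt_one_of_one_lt_of_neg one_lt_two (by linarith)
  have := (summable_nat_add_iff (N + 1)).2 (summable_geometric_of_lt_one (by positivity) hlt)
  exact this.congr fun j => by congr 1; ring

end Dyadic

/-! ### The estimate for a single step h -/

/-- The constant at `t^k E_{k+r}(f)_p`. -/
noncomputable def inverseConst (k r N : ℕ) : ℝ :=
  2 * (diffConst k r * (2 ^ N) ^ r * (2 ^ N) ^ k)

theorem inverse_theorem_aux (r k : ℕ) (hk : 1 ≤ k) (α : ℝ) (hα : (r : ℝ) < α)
    (hαk : α < (r : ℝ) + k) :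
    ∃ c : ℝ, 0 ≤ c ∧ ∀ p : ℝ≥0∞, 1 ≤ p → ∀ f : ℝ → ℝ, MemLp f p μI → ∀ N : ℕ, k + r ≤ N →
      (∀ n : ℕ, N ≤ n → bestApprox n p f ≤ ENNReal.ofReal ((n : ℝ) ^ (-α))) →
      (∃ g : ℝ → ℝ, g =ᵐ[μI] f ∧ MemB p r g) ∧
      ∀ g : ℝ → ℝ, g =ᵐ[μI] f → MemB p r g → ∀ h t : ℝ, 0 ≤ h → h ≤ t → 0 < t →
        eLpNorm (fun x => wt (k * h) x ^ r * symmDiffK k (h * phi x) (iteratedDeriv r g) x) p μI ≤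
          ENNReal.ofReal (c * t ^ (α - r)) +
            ENNReal.ofReal (inverseConst k r N * h ^ k) * bestApprox (k + r) p f := by
  obtain ⟨A, hA, hsum⟩ := exists_dyadic_sum_le k (β := α - r) (by linarith) (by linarith)
  have hK := diffConst_pos hk r
  have hα0 : 0 < α := (Nat.cast_nonneg r).trans_lt hα
  refine ⟨diffConst k r * (4 * 2 ^ α) * A, by positivity, fun p hp f hf N hN hE => ?_⟩
  have hEtop : bestApprox (k + r) p f < ⊤ := by
    refine lt_of_le_of_lt (iInf₂_le (0 : Polynomial ℝ) (by simp)) ?_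
    simpa using hf.2
  refine ⟨?_, fun g hgf hg h t hh hht ht => ?_⟩
  · obtain ⟨P, hPd, hPe, -⟩ := exists_dyadic_approx hN hE hEtop
    exact exists_memB hp (fun s hs => wSummable_dyadic hα hs hp hf hPd hPe) hf
      (tendsto_dyadic hα0 hPe)
  -- Near-best polynomials exist only for y strictly above E_{k+r}(f)_p; y decreases to it at the
  -- end.
  have key : ∀ y, bestApprox (k + r) p f < y →
      eLpNorm (fun x => wt (k * h) x ^ r * symmDiffK k (h * phi x) (iteratedDeriv r g) x) p μI ≤
          ENNReal.ofReal (diffConst k r * (4 * 2 ^ α) * A * t ^ (α - r)) +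
            ENNReal.ofReal (inverseConst k r N * h ^ k) * y := by
    intro y hy
    obtain ⟨P, hPd, hPe, hP0⟩ := exists_dyadic_approx hN hE hy
    obtain ⟨R, hRd, hRe⟩ := exists_of_bestApprox_lt hy
    refine eLpNorm_symmDiffK_le_of_ae_tendsto k r hh
      (F := fun j x => (Polynomial.derivative^[r] (P j)).eval x) (fun j => Polynomial.continuous _)
      (ae_tendsto_iteratedDeriv hp (fun s hs => wSummable_dyadic hα hs hp hf hPd hPe) hf
        (tendsto_dyadic hα0 hPe) hgf hg) fun n => ?_
    refine (eLpNorm_symmDiffK_le_sum k r h hp P n).trans ?_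
    rw [add_comm]
    refine add_le_add ?_ ?_
    · calc _ ≤ ∑ j ∈ Finset.range n, ENNReal.ofReal (diffConst k r * (4 * 2 ^ α) *
            (((2 : ℝ) ^ (N + 1 + j)) ^ (-(α - r)) * min 1 ((2 ^ (N + 1 + j) * t) ^ k))) := by
            refine Finset.sum_le_sum fun j _ => ?_
            refine (eLpNorm_symmDiffK_le_min hk r hh hp (degree_dyadic_sub_lt hPd j)).trans ?_
            refine (mul_le_mul_right (eLpNorm_dyadic_sub_le hα0 hp hf hPe j) _).trans ?_
            rw [← ENNReal.ofReal_mul (by positivity)]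
            refine ENNReal.ofReal_le_ofReal ?_
            have e : N + 1 + j = N + j + 1 := by ring
            rw [e, neg_sub, sub_eq_add_neg, Real.rpow_add (by positivity), Real.rpow_natCast]
            push_cast
            calc _ = diffConst k r * (4 * 2 ^ α) * (((2 : ℝ) ^ (N + j + 1)) ^ r *
                  ((2 : ℝ) ^ (N + j + 1)) ^ (-α) * min 1 ((2 ^ (N + j + 1) * h) ^ k)) := by ring
              _ ≤ _ := by gcongr
        _ = ENNReal.ofReal (diffConst k r * (4 * 2 ^ α) * ∑ j ∈ Finset.range n,
            (((2 : ℝ) ^ (N + 1 + j)) ^ (-(α - r)) * min 1 ((2 ^ (N + 1 + j) * t) ^ k))) := by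
            rw [Finset.mul_sum, ENNReal.ofReal_sum_of_nonneg fun j _ => by positivity]
        _ ≤ _ := by
            refine ENNReal.ofReal_le_ofReal ?_
            rw [mul_assoc _ A]
            -- The sum over exponents from N + 1 on is completed to start at 0; this keeps the
            -- constant independent of N.
            refine mul_le_mul_of_nonneg_left (le_trans ?_ (hsum t ht (N + 1 + n))) (by positivity)
            rw [Finset.sum_range_add _ (N + 1) n]
            exact le_add_of_nonneg_left (Finset.sum_nonneg fun i _ => by positivity)
    · have hdeg : (P 0 - R).degree < ((2 ^ N : ℕ) : WithBot ℕ) := by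
        refine (Polynomial.degree_sub_le _ _).trans_lt (max_lt (hPd 0) (hRd.trans_le ?_))
        exact_mod_cast hN.trans Nat.lt_two_pow_self.le
      -- Subtracting R changes nothing at order k + r, and ‖P 0 - R‖ is at most 2y by the triangle
      -- inequality through f.
      have hder : Polynomial.derivative^[k + r] (P 0) =
          Polynomial.derivative^[k + r] (P 0 - R) := by
        rw [Polynomial.iterate_derivative_sub, Polynomial.iterate_derivative_eq_zero_of_degree_lt hRd,
          sub_zero]
      refine (eLpNorm_symmDiffK_le_pow hk r hh hp hdeg hder).trans ?_
      calc _ ≤ ENNReal.ofReal (diffConst k r * (2 ^ N : ℕ) ^ r * ((2 ^ N : ℕ) * h) ^ k) *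
            (2 * y) := by
            refine mul_le_mul_right ((eLpNorm_eval_sub_le hp hf _ _).trans ?_) _
            rw [two_mul]
            exact add_le_add hP0 hRe.le
        _ = _ := by
            rw [← mul_assoc, mul_comm _ (2 : ℝ≥0∞), ← ENNReal.ofReal_ofNat 2,
              ← ENNReal.ofReal_mul (by positivity)]
            congr 2
            rw [inverseConst]
            push_cast
            ring
  have hne : (𝓝[>] bestApprox (k + r) p f).NeBot := by
    exact nhdsGT_neBot_of_exists_gt ⟨⊤, hEtop⟩
  have hcont : Tendsto (fun y => ENNReal.ofReal (diffConst k r * (4 * 2 ^ α) * A * t ^ (α - r)) +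
      ENNReal.ofReal (inverseConst k r N * h ^ k) * y) (𝓝[>] bestApprox (k + r) p f)
      (𝓝 (ENNReal.ofReal (diffConst k r * (4 * 2 ^ α) * A * t ^ (α - r)) +
      ENNReal.ofReal (inverseConst k r N * h ^ k) * bestApprox (k + r) p f)) := by
    refine Tendsto.mono_left ?_ nhdsWithin_le_nhds
    exact tendsto_const_nhds.add
      (ENNReal.Tendsto.const_mul tendsto_id (Or.inr ENNReal.ofReal_ne_top))
  exact ge_of_tendsto hcont (eventually_nhdsWithin_of_forall fun y hy => key y hy)

/-- The half-width kh/2 then exceeds 1, and no point of (-1, 1) admits the difference. Thus only h ≤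
2 matters, whatever t is. -/
lemma eLpNorm_symmDiffK_eq_zero (k r : ℕ) {h : ℝ} (hk : 1 ≤ k) (hh : 2 < h) (p : ℝ≥0∞)
    (F : ℝ → ℝ) :
    eLpNorm (fun x => wt (k * h) x ^ r * symmDiffK k (h * phi x) F x) p μI = 0 := by
  have hk' : (1 : ℝ) ≤ k := by exact_mod_cast hk
  have : diffDom (k * h / 2) = ∅ := by
    refine eq_empty_of_forall_notMem fun x hx => ?_
    have := le_one_of_mem_diffDom hx
    nlinarith
  rw [eLpNorm_wt_symmDiffK, this, Measure.restrict_empty, eLpNorm_measure_zero]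

end AlgApprox

/-! ### Choice of constants and the supremum over h -/

theorem mainTheorem7 (r k : ℕ) (hk : 1 ≤ k) :
    ∃ (c : ℝ → ℝ≥0) (C : ℕ → ℝ≥0),
      ∀ (α : ℝ), (r : ℝ) < α → α < (r : ℝ) + (k : ℝ) →
      ∀ (p : ℝ≥0∞), 1 ≤ p →
      ∀ (f : ℝ → ℝ), MemLp f p AlgApprox.μI →
      ∀ (N : ℕ), k + r ≤ N →
      (∀ n : ℕ, N ≤ n → AlgApprox.bestApprox n p f ≤ ENNReal.ofReal ((n : ℝ) ^ (-α))) →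
        (∃ g : ℝ → ℝ, g =ᵐ[AlgApprox.μI] f ∧ AlgApprox.MemB p r g) ∧
        ∀ g : ℝ → ℝ, g =ᵐ[AlgApprox.μI] f → AlgApprox.MemB p r g →
          (∀ t : ℝ, 0 < t →
            AlgApprox.modulus k r p (iteratedDeriv r g) t ≤
              (c α : ℝ≥0∞) * ENNReal.ofReal (t ^ (α - (r : ℝ))) +
                (C N : ℝ≥0∞) * ENNReal.ofReal (t ^ k) * AlgApprox.bestApprox (k + r) p f) ∧
          (N = k + r → ∀ t : ℝ, 0 < t →
            AlgApprox.modulus k r p (iteratedDeriv r g) t ≤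
              (c α : ℝ≥0∞) * ENNReal.ofReal (t ^ (α - (r : ℝ)))) := by
  classical
  have hC : ∀ N, 0 ≤ AlgApprox.inverseConst k r N := fun N => by
    have := (AlgApprox.diffConst_pos hk r).le
    unfold AlgApprox.inverseConst
    positivity
  -- Outside the admissible range of α the constant is 0 by default, so that c becomes a function on
  -- all of ℝ.
  have hex : ∀ α : ℝ, ∃ c : ℝ, 0 ≤ c ∧ ((r : ℝ) < α → α < (r : ℝ) + (k : ℝ) → _) := fun α => by
    by_cases h : (r : ℝ) < α ∧ α < (r : ℝ) + (k : ℝ)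
    · obtain ⟨c, hc, H⟩ := AlgApprox.inverse_theorem_aux r k hk α h.1 h.2
      exact ⟨c, hc, fun _ _ => H⟩
    · exact ⟨0, le_rfl, fun h1 h2 => absurd ⟨h1, h2⟩ h⟩
  choose c hc H using hex
  -- `D` absorbs the second term when N = k + r: then E_{k+r}(f)_p ≤ 1, and h^k ≤ 2^k t^(α-r) for h
  -- ≤ min(2, t).
  set D : ℝ := AlgApprox.inverseConst k r (k + r) * 2 ^ k with hD
  have hD0 : 0 ≤ D := mul_nonneg (hC _) (by positivity)
  refine ⟨fun α => Real.toNNReal (c α + D), fun N => Real.toNNReal (AlgApprox.inverseConst k r N),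
    fun α hα hαk p hp f hf N hN hE => ?_⟩
  obtain ⟨hg0, hmain⟩ := H α hα hαk p hp f hf N hN hE
  refine ⟨hg0, fun g hgf hg => ⟨fun t ht => ?_, fun hNk t ht => ?_⟩⟩
  · refine iSup₂_le fun h hh => (hmain g hgf hg h t hh.1 hh.2 ht).trans ?_
    change _ ≤ ENNReal.ofReal (c α + D) * _ + ENNReal.ofReal (AlgApprox.inverseConst k r N) * _ * _
    rw [← ENNReal.ofReal_mul (add_nonneg (hc α) hD0), ← ENNReal.ofReal_mul (hC N)]
    have hC' := hC N
    have hh0 := hh.1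
    have hht := hh.2
    gcongr
    linarith
  · refine iSup₂_le fun h hh => ?_
    change _ ≤ ENNReal.ofReal (c α + D) * _
    rcases lt_or_ge 2 h with h2 | h2
    · rw [AlgApprox.eLpNorm_symmDiffK_eq_zero k r hk h2]
      exact zero_le
    refine (hmain g hgf hg h t hh.1 hh.2 ht).trans ?_
    have hα0 : 0 < α := (Nat.cast_nonneg r).trans_lt hα
    have hE1 : AlgApprox.bestApprox (k + r) p f ≤ 1 := by
      rw [← hNk]
      refine (hE N le_rfl).trans ?_
      rw [ENNReal.ofReal_le_one]
      exact Real.rpow_le_one_of_one_le_of_nonpos (by exact_mod_cast (by omega : 1 ≤ N))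
        (by linarith)
    have hpow : h ^ k ≤ 2 ^ k * t ^ (α - r) := by
      rcases hh.1.eq_or_lt with h0 | h0
      · rw [← h0, zero_pow (by omega)]; positivity
      calc h ^ k = h ^ ((k : ℝ) - (α - r)) * h ^ (α - r) := by
            rw [← Real.rpow_add h0, sub_add_cancel, Real.rpow_natCast]
        _ ≤ 2 ^ ((k : ℝ) - (α - r)) * t ^ (α - r) := by
            have a1 : 0 ≤ (k : ℝ) - (α - r) := by linarith
            have a2 : 0 ≤ α - (r : ℝ) := by linarith
            have := hh.2
            gcongr
        _ ≤ 2 ^ k * t ^ (α - r) := by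
            gcongr
            rw [← Real.rpow_natCast]
            exact Real.rpow_le_rpow_of_exponent_le one_le_two (by linarith)
    have hh0 := hh.1
    have hC' := hC N
    calc _ ≤ ENNReal.ofReal (c α * t ^ (α - r)) +
          ENNReal.ofReal (AlgApprox.inverseConst k r N * h ^ k) * 1 := by gcongr
      _ = ENNReal.ofReal (c α * t ^ (α - r) + AlgApprox.inverseConst k r N * h ^ k) := by
          have := hc α
          rw [mul_one, ENNReal.ofReal_add (by positivity) (by positivity)]
      _ ≤ ENNReal.ofReal ((c α + D) * t ^ (α - r)) := by
          refine ENNReal.ofReal_le_ofReal ?_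
          rw [add_mul, hD, hNk, mul_assoc]
          have := hC (k + r)
          gcongr
      _ = _ := ENNReal.ofReal_mul (add_nonneg (hc α) hD0)
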